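/- Let $G$ be a compact Lie group whose Lie algebra $\mathfrak g$ (the tangent space at the identity, identified with the left-invariant vector fields) is simple, let $\langle\cdot,\cdot\rangle$ be an inner product on $\mathfrak g$ that is invariant under the adjoint representation, $\langle [x,y],z\rangle=-\langle y,[x,z]\rangle$, and let $k\neq 0$ be a real number. Let $\theta_L$ be the left-invariant Maurer–Cartan form of $G$ and let $\nu_k=k\langle\theta_L,[\theta_L,\theta_L]\rangle$, that is, $\nu_k(u,v,w)=k\langle\theta_L(u),[\theta_L(v),\theta_L(w)]\rangle$; this is a closed nondegenerate 3-form on $G$. A *Lie 2-algebra* is a 2-term complex of real vector spaces $d\colon L_1\to L_0$ with a skew-symmetric chain map $[\cdot,\cdot]\colon L\otimes L\to L$ and a skew-symmetric chain homotopy $J\colon L^{\otimes 3}\to L$ from $[x,[y,z]]$ to $[[x,y],z]+[y,[x,z]]$ such that $$[x,J(y,z,w)]+J(x,[y,z],w)+J(x,z,[y,w])+[J(x,y,z),w]+[z,J(x,y,w)]=J(x,y,[z,w])+J([x,y],z,w)+[y,J(x,z,w)]+J(y,[x,z],w)+J(y,z,[x,w]).$$ A *morphism* $L\to L'$ is a chain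 map $\phi$ together with a chain homotopy $\Phi$ from $\phi([x,y])$ to $[\phi(x),\phi(y)]'$ such that $$\phi_1(J(x,y,z))-J'(\phi_0(x),\phi_0(y),\phi_0(z))=\Phi(x,[y,z])-\Phi([x,y],z)-\Phi(y,[x,z])-[\Phi(x,y),\phi_0(z)]'+[\phi_0(x),\Phi(y,z)]'-[\phi_0(y),\Phi(x,z)]'.$$ It is a *quasi-isomorphism* if $\phi$ induces isomorphisms on $H_0$ and $H_1$. Two Lie 2-algebras are *quasi-isomorphic* if there is a quasi-isomorphism from one of them to the other, in either direction. The *Lie 2-algebra of Hamiltonian 1-forms* $\mathrm{Lie}(G,\nu_k)$ has $L_0=\{\alpha\in\Omega^1(G) : d\alpha=-\iota_{v_\alpha}\nu_k \text{ for some smooth vector field } v_\alpha\}$ ($v_\alpha$ is then unique), $L_1=C^\infty(G)$, the de Rham differential $d\colon L_1\to L_0$, the bracket $\{\alpha,\beta\}=\iota_{v_\beta}\iota_{v_\alpha}\nu_k$ in degree $0$ and zero otherwise, and $J(\alpha,\beta,\gamma)=\iota_{v_\alpha}\iota_{v_\beta}\iota_{v_\gamma}\nu_k$. The *string Lie 2-algebra*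 $\mathfrak g_k$ has $L_0=\mathfrak g$, $L_1=\mathbb R$, $d=0$, the Lie bracket of $\mathfrak g$ in degree $0$ and zero bracket otherwise, and $J(x,y,z)=k\langle x,[y,z]\rangle$. Then $\mathrm{Lie}(G,\nu_k)$ and $\mathfrak g_k$ are not quasi-isomorphic. -/

import Mathlib

open scoped Manifold ContDiff

set_option linter.checkUnivs false

universe u v u' v'

/-- A Lie 2-algebra over `ℝ`: a 2-term chain complex `d : L₁ → L₀` with a skew-symmetric
bracket that is a chain map and a skew-symmetric Jacobiator `J` that is a chain homotopy.
The bracket is given by its components `[x, y]` (`br x y`) and `[x, a]` (`act x a`) for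
`x, y ∈ L₀`, `a ∈ L₁`; by graded skew-symmetry `[a, x] = -[x, a]`, and `[a, b] = 0` for degree
reasons. A chain homotopy `h` from `F` to `G` satisfies `F - G = d h + h d`. -/
structure Lie2Algebra where
  L0 : Type u
  L1 : Type v
  [addCommGroup0 : AddCommGroup L0]
  [module0 : Module ℝ L0]
  [addCommGroup1 : AddCommGroup L1]
  [module1 : Module ℝ L1]
  /-- the differential -/
  d : L1 →ₗ[ℝ] L0
  /-- the bracket `[x, y]` in degree 0 -/
  br : L0 →ₗ[ℝ] L0 →ₗ[ℝ] L0
  /-- the bracket `[x, a]` in degree 1 -/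
  act : L0 →ₗ[ℝ] L1 →ₗ[ℝ] L1
  br_skew : ∀ x y, br x y = -br y x
  /-- chain map: `d [x, a] = [x, d a]` -/
  d_act : ∀ x a, d (act x a) = br x (d a)
  /-- chain map: `[d a, b] - [a, d b] = 0` -/
  act_d : ∀ a b, act (d a) b + act (d b) a = 0
  /-- the Jacobiator -/
  J : L0 →ₗ[ℝ] L0 →ₗ[ℝ] L0 →ₗ[ℝ] L1
  J_skew₁₂ : ∀ x y z, J x y z = -J y x z
  J_skew₂₃ : ∀ x y z, J x y z = -J x z y
  /-- `J` is a homotopy from `[x, [y, z]]` to `[[x, y], z] + [y, [x, z]]`, in degree 0 -/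
  d_J : ∀ x y z, d (J x y z) = br x (br y z) - (br (br x y) z + br y (br x z))
  /-- the same in degree 1 -/
  J_d : ∀ x y a, J x y (d a) = act x (act y a) - (act (br x y) a + act y (act x a))
  coherence : ∀ x y z w,
    act x (J y z w) + J x (br y z) w + J x z (br y w) - act w (J x y z) + act z (J x y w)
      = J x y (br z w) + J (br x y) z w + act y (J x z w) + J y (br x z) w + J y z (br x w)

namespace Lie2Algebra

attribute [instance] addCommGroup0 module0 addCommGroup1 module1

/-- A morphism of Lie 2-algebras: a chain map `(f0, f1)` and a chain homotopy `Φ` from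
`φ [x, y]` to `[φ x, φ y]'`, compatible with the Jacobiators. -/
structure Hom (L : Lie2Algebra.{u, v}) (L' : Lie2Algebra.{u', v'}) where
  f0 : L.L0 →ₗ[ℝ] L'.L0
  f1 : L.L1 →ₗ[ℝ] L'.L1
  comm : ∀ a, f0 (L.d a) = L'.d (f1 a)
  Φ : L.L0 →ₗ[ℝ] L.L0 →ₗ[ℝ] L'.L1
  d_Φ : ∀ x y, L'.d (Φ x y) = f0 (L.br x y) - L'.br (f0 x) (f0 y)
  Φ_d_right : ∀ x a, Φ x (L.d a) = f1 (L.act x a) - L'.act (f0 x) (f1 a)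
  Φ_d_left : ∀ a x, Φ (L.d a) x = -f1 (L.act x a) + L'.act (f0 x) (f1 a)
  compat : ∀ x y z, f1 (L.J x y z) - L'.J (f0 x) (f0 y) (f0 z) =
    Φ x (L.br y z) - Φ (L.br x y) z - Φ y (L.br x z) + L'.act (f0 z) (Φ x y)
      + L'.act (f0 x) (Φ y z) - L'.act (f0 y) (Φ x z)

/-- `H₁(L) = ker d`. -/
abbrev H1 (L : Lie2Algebra.{u, v}) : Type v := LinearMap.ker L.d

/-- `H₀(L) = L₀ / im d`. -/
abbrev H0 (L : Lie2Algebra.{u, v}) : Type u := L.L0 ⧸ LinearMap.range L.d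

variable {L : Lie2Algebra.{u, v}} {L' : Lie2Algebra.{u', v'}}

/-- The map induced on `H₁`. -/
def Hom.mapH1 (φ : Hom L L') : H1 L →ₗ[ℝ] H1 L' :=
  φ.f1.restrict fun a (ha : L.d a = 0) => show L'.d (φ.f1 a) = 0 by
    rw [← φ.comm, ha, map_zero]

/-- The map induced on `H₀`. -/
def Hom.mapH0 (φ : Hom L L') : H0 L →ₗ[ℝ] H0 L' :=
  Submodule.mapQ _ _ φ.f0 <| by
    rintro _ ⟨a, rfl⟩
    exact ⟨φ.f1 a, (φ.comm a).symm⟩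

/-- A quasi-isomorphism: a morphism that induces isomorphisms on homology. -/
def Hom.IsQuasiIso (φ : Hom L L') : Prop :=
  Function.Bijective φ.mapH1 ∧ Function.Bijective φ.mapH0

/-- `L` and `L'` are quasi-isomorphic if there is a quasi-isomorphism between them, in either
direction. -/
def QuasiIsomorphic (L : Lie2Algebra.{u, v}) (L' : Lie2Algebra.{u', v'}) : Prop :=
  (∃ φ : Hom L L', φ.IsQuasiIso) ∨ ∃ φ : Hom L' L, φ.IsQuasiIso

end Lie2Algebra

/-- An inner product on a real Lie algebra that is invariant under the adjoint
representation: `⟪[x, y], z⟫ = -⟪y, [x, z]⟫`. -/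
structure InvariantInnerProduct (𝔤 : Type u) [LieRing 𝔤] [LieAlgebra ℝ 𝔤] where
  form : LinearMap.BilinForm ℝ 𝔤
  symm : ∀ x y, form x y = form y x
  pos : ∀ x, x ≠ 0 → 0 < form x x
  invariant : form.lieInvariant 𝔤

namespace InvariantInnerProduct

variable {𝔤 : Type u} [LieRing 𝔤] [LieAlgebra ℝ 𝔤] (B : InvariantInnerProduct 𝔤) (k : ℝ)

/-- The trilinear form `(x, y, z) ↦ k ⟪x, [y, z]⟫`. -/
def tri : 𝔤 →ₗ[ℝ] 𝔤 →ₗ[ℝ] 𝔤 →ₗ[ℝ] ℝ :=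
  LinearMap.mk₂ ℝ (fun x y => k • (B.form x ∘ₗ (LieModule.toEnd ℝ 𝔤 𝔤 y)))
    (fun x x' y => by ext z; simp [mul_add]) (fun c x y => by ext z; simp; ring)
    (fun x y y' => by ext z; simp [mul_add]) (fun c x y => by ext z; simp; ring)

@[simp] lemma tri_apply (x y z : 𝔤) : B.tri k x y z = k * B.form x ⁅y, z⁆ := by
  simp [tri]

lemma form_lie (x y z : 𝔤) : B.form x ⁅y, z⁆ = B.form ⁅x, y⁆ z := by
  have := B.invariant y x z
  rw [← lie_skew x y, map_neg, LinearMap.neg_apply]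
  linarith

lemma tri_skew₂₃ (x y z : 𝔤) : B.tri k x y z = -B.tri k x z y := by
  simp only [tri_apply]
  rw [← lie_skew, map_neg]; ring

lemma tri_skew₁₂ (x y z : 𝔤) : B.tri k x y z = -B.tri k y x z := by
  simp only [tri_apply, form_lie]
  rw [← lie_skew, map_neg, LinearMap.neg_apply]; ring

/-- The cocycle identity for `tri`. -/
lemma tri_cocycle (x y z w : 𝔤) :
    B.tri k x ⁅y, z⁆ w + B.tri k x z ⁅y, w⁆ = B.tri k x y ⁅z, w⁆ + B.tri k ⁅x, y⁆ z w
      + B.tri k y ⁅x, z⁆ w + B.tri k y z ⁅x, w⁆ := by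
  have h1 : B.tri k y ⁅x, z⁆ w = - B.tri k ⁅x, z⁆ y w := tri_skew₁₂ ..
  have h2 : B.tri k y z ⁅x, w⁆ = B.tri k ⁅x, w⁆ y z := by
    rw [tri_skew₂₃, tri_skew₁₂]; ring
  rw [h1, h2]
  simp only [tri_apply]
  have e1 : B.form x ⁅⁅y, z⁆, w⁆ = B.form ⁅x, ⁅y, z⁆⁆ w := form_lie ..
  have e4 : B.form ⁅x, w⁆ ⁅y, z⁆ = - B.form ⁅x, ⁅y, z⁆⁆ w := B.invariant x w ⁅y, z⁆ |>.trans (by rw [B.symm])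
  have e5 : B.form ⁅x, z⁆ ⁅y, w⁆ = B.form ⁅⁅x, z⁆, y⁆ w := form_lie ..
  have e6 : B.form ⁅x, y⁆ ⁅z, w⁆ = B.form ⁅⁅x, y⁆, z⁆ w := form_lie ..
  have e2 : B.form x ⁅z, ⁅y, w⁆⁆ = B.form ⁅⁅x, z⁆, y⁆ w := by rw [form_lie, form_lie]
  have e3 : B.form x ⁅y, ⁅z, w⁆⁆ = B.form ⁅⁅x, y⁆, z⁆ w := by rw [form_lie, form_lie]
  rw [e1, e2, e3, e4, e5, e6]
  have hj : ⁅x, ⁅y, z⁆⁆ = ⁅⁅x, y⁆, z⁆ - ⁅⁅x, z⁆, y⁆ := by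
    rw [leibniz_lie, ← lie_skew y ⁅x, z⁆]; abel
  rw [hj]; simp; ring

/-- The string Lie 2-algebra `𝔤_k`: `L₀ = 𝔤`, `L₁ = ℝ`, `d = 0`, the bracket is the Lie bracket
of `𝔤` in degree 0 and zero otherwise, and the Jacobiator is `k ⟪x, [y, z]⟫`. -/
def stringLie2Algebra : Lie2Algebra.{u, 0} where
  L0 := 𝔤
  L1 := ℝ
  d := 0
  br := (LieModule.toEnd ℝ 𝔤 𝔤 : 𝔤 →ₗ[ℝ] 𝔤 →ₗ[ℝ] 𝔤)
  act := 0
  br_skew x y := by simp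
  d_act x a := by simp
  act_d a b := by simp
  J := B.tri k
  J_skew₁₂ := B.tri_skew₁₂ k
  J_skew₂₃ := B.tri_skew₂₃ k
  d_J x y z := by simp
  J_d x y a := by simp
  coherence x y z w := by simpa using B.tri_cocycle k x y z w

end InvariantInnerProduct

instance FiniteDimensional.completeSpaceReal (E : Type*) [NormedAddCommGroup E] [NormedSpace ℝ E]
    [FiniteDimensional ℝ E] : CompleteSpace E := FiniteDimensional.complete ℝ E

instance minSmoothness_real_two_leInfty : ENat.LEInfty (minSmoothness ℝ 2) :=
  ⟨by rw [minSmoothness_of_isRCLikeNormedField]; exact ENat.LEInfty.out⟩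

instance minSmoothness_real_three_leInfty : ENat.LEInfty (minSmoothness ℝ 3) :=
  ⟨by rw [minSmoothness_of_isRCLikeNormedField]; exact ENat.LEInfty.out⟩

noncomputable section Manifold

set_option linter.unusedSectionVars false

variable (E : Type u) [NormedAddCommGroup E] [NormedSpace ℝ E] [FiniteDimensional ℝ E]
  (M : Type v) [TopologicalSpace M] [ChartedSpace E M] [IsManifold 𝓘(ℝ, E) ∞ M]

/-- Smooth vector fields on `M`. -/
abbrev VField : Type (max u v) :=
  Cₛ^∞⟮𝓘(ℝ, E); E, (TangentSpace 𝓘(ℝ, E) : M → Type u)⟯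

variable {E M}

namespace VField

/-- The Lie bracket of smooth vector fields. -/
def lie (X Y : VField E M) : VField E M where
  toFun := VectorField.mlieBracket 𝓘(ℝ, E) X Y
  contMDiff_toFun := by
    have : IsManifold 𝓘(ℝ, E) (((⊤ : ℕ∞) : WithTop ℕ∞) + 1) M :=
      inferInstanceAs (IsManifold 𝓘(ℝ, E) ∞ M)
    exact ContDiff.mlieBracket_vectorField (m := ⊤) (n := ⊤) X.contMDiff Y.contMDiff (by simp)

/-- The derivative `X f` of a smooth function along a vector field. -/
def deriv (X : VField E M) (f : C^∞⟮𝓘(ℝ, E), M; ℝ⟯) : C^∞⟮𝓘(ℝ, E), M; ℝ⟯ where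
  val x := d% f x (X x)
  property := by
    have h1 : ContMDiff 𝓘(ℝ, E).tangent 𝓘(ℝ, ℝ).tangent ∞ (tangentMap 𝓘(ℝ, E) 𝓘(ℝ, ℝ) f) :=
      f.contMDiff.contMDiff_tangentMap (by simp)
    exact (contMDiff_snd_tangentBundle_modelSpace ℝ 𝓘(ℝ, ℝ)).comp (h1.comp X.contMDiff)

/-- The product of a smooth function and a smooth vector field. -/
def fsmul (f : C^∞⟮𝓘(ℝ, E), M; ℝ⟯) (X : VField E M) : VField E M where
  toFun := (f : M → ℝ) • (X : Π x, TangentSpace 𝓘(ℝ, E) x)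
  contMDiff_toFun := f.contMDiff.smul_section X.contMDiff

variable (X Y Z : VField E M) (f g : C^∞⟮𝓘(ℝ, E), M; ℝ⟯)

lemma mdf (f : C^∞⟮𝓘(ℝ, E), M; ℝ⟯) (x : M) : MDiffAt f x := f.contMDiff.mdifferentiableAt (by simp)

@[simp] lemma fsmul_apply (x : M) : fsmul f X x = f x • X x := rfl
@[simp] lemma deriv_apply (x : M) : deriv X f x = d% f x (X x) := rfl
lemma lie_apply (x : M) : lie X Y x = VectorField.mlieBracket 𝓘(ℝ, E) X Y x := rfl

lemma deriv_add : X.deriv (f + g) = X.deriv f + X.deriv g := by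
  ext x
  change d% (f + g : M → ℝ) x (X x) = _
  rw [mvfderiv_add (mdf f x) (mdf g x)]; rfl

lemma deriv_const (c : ℝ) : X.deriv (ContMDiffMap.const c) = 0 := by
  ext x
  change d% (fun _ : M => c) x (X x) = _
  rw [mvfderiv_const]; rfl

lemma deriv_zero : X.deriv 0 = 0 := deriv_const X 0

lemma deriv_neg : X.deriv (-f) = - X.deriv f := by
  ext x
  change d% (-f : M → ℝ) x (X x) = _
  rw [mvfderiv_neg]; rfl

lemma deriv_sub : X.deriv (f - g) = X.deriv f - X.deriv g := by
  rw [sub_eq_add_neg, deriv_add, deriv_neg, sub_eq_add_neg]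

lemma deriv_mul : X.deriv (f * g) = f * X.deriv g + g * X.deriv f := by
  ext x
  change d% (f * g : M → ℝ) x (X x) = _
  rw [mvfderiv_mul (mdf f x) (mdf g x)]; rfl

lemma deriv_smul (c : ℝ) : X.deriv (c • f) = c • X.deriv f := by
  have h : c • f = ContMDiffMap.const c * f := rfl
  rw [h, deriv_mul, deriv_const, mul_zero, add_zero]; rfl

lemma add_deriv : (X + Y).deriv f = X.deriv f + Y.deriv f := by
  ext x; simp

lemma lie_swap : X.lie Y = - Y.lie X := by
  ext1 x; simpa [lie_apply] using VectorField.mlieBracket_swap_apply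

lemma lie_add : X.lie (Y + Z) = X.lie Y + X.lie Z := by
  ext1 x
  exact VectorField.mlieBracket_add_right Y.mdifferentiableAt Z.mdifferentiableAt

lemma add_lie : (X + Y).lie Z = X.lie Z + Y.lie Z := by
  rw [lie_swap, lie_add, lie_swap Z X, lie_swap Z Y]; abel

lemma lie_fsmul : X.lie (fsmul f Y) = fsmul (X.deriv f) Y + fsmul f (X.lie Y) := by
  ext1 x
  exact VectorField.mlieBracket_smul_right (mdf f x) Y.mdifferentiableAt

lemma fsmul_deriv : (fsmul f X).deriv g = f * X.deriv g := by
  ext x; simp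

lemma fsmul_lie : (fsmul f X).lie Y = fsmul f (X.lie Y) + -fsmul (Y.deriv f) X := by
  rw [lie_swap, lie_fsmul, lie_swap Y X]
  ext1 x
  simp only [ContMDiffSection.coe_neg, ContMDiffSection.coe_add, Pi.neg_apply, Pi.add_apply,
    fsmul_apply, smul_neg]
  abel

lemma jacobi : X.lie (Y.lie Z) = (X.lie Y).lie Z + Y.lie (X.lie Z) := by
  ext1 x
  exact VectorField.leibniz_identity_mlieBracket_apply
    (X.contMDiff.contMDiffAt.of_le ENat.LEInfty.out) (Y.contMDiff.contMDiffAt.of_le ENat.LEInfty.out)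
    (Z.contMDiff.contMDiffAt.of_le ENat.LEInfty.out)

variable [T2Space M]

/-- Every tangent vector extends to a smooth vector field. -/
lemma exists_extension (x : M) (v : TangentSpace 𝓘(ℝ, E) x) : ∃ X : VField E M, X x = v := by
  obtain ⟨s, hs, hc⟩ := FiberBundle.exists_contMDiffOn_extend (k := ∞) 𝓘(ℝ, E) E v
  obtain ⟨u, hus, huo, hxu⟩ := mem_nhds_iff.1 hs
  obtain ⟨f, -, hf⟩ := (SmoothBumpFunction.nhds_basis_tsupport (I := 𝓘(ℝ, E)) x).mem_iff.1
    (huo.mem_nhds hxu)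
  exact ⟨⟨_, ContMDiffOn.smul_section_of_tsupport f.contMDiff.contMDiffOn huo hf (hc.mono hus)⟩, by
    simp⟩

lemma lie_deriv : (X.lie Y).deriv f = X.deriv (Y.deriv f) - Y.deriv (X.deriv f) := by
  ext x
  by_cases h : ∃ v : TangentSpace 𝓘(ℝ, E) x, v ≠ 0
  · obtain ⟨v, hv⟩ := h
    obtain ⟨Z, rfl⟩ := exists_extension x v
    have h1 := jacobi X Y (fsmul f Z)
    simp only [lie_fsmul, lie_add] at h1
    have h2 := congrArg (fun W : VField E M => W x) (h1)
    have h3 := congrArg (fun W : VField E M => W x) (jacobi X Y Z)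
    simp only [ContMDiffSection.coe_add, Pi.add_apply, fsmul_apply] at h2 h3
    rw [h3] at h2
    have h4 : (((X.lie Y).deriv f) x - (X.deriv (Y.deriv f) x - Y.deriv (X.deriv f) x)) • Z x = 0 := by
      simp only [sub_smul]
      rw [smul_add] at h2
      rw [← sub_eq_zero] at h2
      rw [← neg_eq_zero, ← h2]
      abel
    have h5 := (smul_eq_zero.1 h4).resolve_right hv
    rw [sub_eq_zero] at h5
    exact h5
  · push Not at h
    change d% f x ((X.lie Y) x) = d% (Y.deriv f) x (X x) - d% (X.deriv f) x (Y x)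
    rw [h ((X.lie Y) x), h (X x), h (Y x)]
    simp

end VField


variable (E M) in
/-- Families of linear forms on the tangent spaces that yield a smooth function on every smooth
vector field. -/
def oneFormSubmodule : Submodule ℝ (Π x : M, TangentSpace 𝓘(ℝ, E) x →ₗ[ℝ] ℝ) where
  carrier := {α | ∀ X : VField E M, ContMDiff 𝓘(ℝ, E) 𝓘(ℝ, ℝ) ∞ fun x => α x (X x)}
  add_mem' ha hb X := (ha X).add (hb X)
  zero_mem' _ := contMDiff_const
  smul_mem' _ _ ha X := contMDiff_const.mul (ha X)

variable (E M) in
/-- Differential 1-forms on `M`. -/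
def OneForm : Type (max u v) := oneFormSubmodule E M

instance : AddCommGroup (OneForm E M) := inferInstanceAs (AddCommGroup (oneFormSubmodule E M))

instance : Module ℝ (OneForm E M) := inferInstanceAs (Module ℝ (oneFormSubmodule E M))

namespace OneForm

/-- The smooth function `α(X)`. -/
def ev (α : OneForm E M) (X : VField E M) : C^∞⟮𝓘(ℝ, E), M; ℝ⟯ := ⟨fun x => α.1 x (X x), α.2 X⟩

/-- The exterior derivative of a 1-form, evaluated on vector fields:
`dα(X, Y) = X(α(Y)) - Y(α(X)) - α([X, Y])`. -/
def extDeriv (α : OneForm E M) (X Y : VField E M) : C^∞⟮𝓘(ℝ, E), M; ℝ⟯ :=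
  X.deriv (ev α Y) - Y.deriv (ev α X) - ev α (X.lie Y)

variable (α β : OneForm E M) (X Y Z : VField E M)

@[simp] lemma add_ev : ev (α + β) X = ev α X + ev β X := rfl
@[simp] lemma smul_ev (c : ℝ) : ev (c • α) X = c • ev α X := rfl
@[simp] lemma zero_ev : ev (0 : OneForm E M) X = 0 := rfl
lemma ev_add : ev α (X + Y) = ev α X + ev α Y := by
  ext x; exact map_add (α.1 x) (X x) (Y x)
lemma ev_neg : ev α (-X) = -ev α X := by
  ext x; exact map_neg (α.1 x) (X x)

lemma extDeriv_add : extDeriv (α + β) X Y = extDeriv α X Y + extDeriv β X Y := by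
  simp only [extDeriv, add_ev, VField.deriv_add]; ring

lemma extDeriv_smul (c : ℝ) : extDeriv (c • α) X Y = c • extDeriv α X Y := by
  simp only [extDeriv, smul_ev, VField.deriv_smul, smul_sub]

variable {α β} in
/-- A 1-form is determined by its values on smooth vector fields. -/
lemma ext_ev [T2Space M] (h : ∀ X, ev α X = ev β X) : α = β := by
  refine Subtype.ext (funext fun x => LinearMap.ext fun v => ?_)
  obtain ⟨X, rfl⟩ := VField.exists_extension x v
  exact congrArg (fun f : C^∞⟮𝓘(ℝ, E), M; ℝ⟯ => f x) (h X)

end OneForm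

/-- The differential `df` of a smooth function. -/
def diff : C^∞⟮𝓘(ℝ, E), M; ℝ⟯ →ₗ[ℝ] OneForm E M where
  toFun f := ⟨fun x => (d% f x : TangentSpace 𝓘(ℝ, E) x →L[ℝ] ℝ), fun X => (X.deriv f).2⟩
  map_add' f g := by
    refine Subtype.ext (funext fun x => LinearMap.ext fun v => ?_)
    change d% (f + g : M → ℝ) x v = _
    rw [mvfderiv_add (VField.mdf f x) (VField.mdf g x)]; rfl
  map_smul' c f := by
    refine Subtype.ext (funext fun x => LinearMap.ext fun v => ?_)
    change d% (((ContMDiffMap.const c : C^∞⟮𝓘(ℝ, E), M; ℝ⟯) : M → ℝ) * f) x v = _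
    rw [mvfderiv_mul (VField.mdf _ x) (VField.mdf f x)]
    change c * (d% f x v) + f x * (d% (fun _ : M => c) x v) = _
    rw [mvfderiv_const]
    simp only [zero_apply, mul_zero, add_zero]
    rfl

@[simp] lemma diff_ev (f : C^∞⟮𝓘(ℝ, E), M; ℝ⟯) (X : VField E M) :
    OneForm.ev (diff f) X = X.deriv f := rfl

variable (E M) in
/-- Differential 3-forms on `M`: families of alternating trilinear forms on the tangent spaces that
yield a smooth function on smooth vector fields. -/
structure ThreeForm where
  toFun : Π x : M, TangentSpace 𝓘(ℝ, E) x [⋀^Fin 3]→ₗ[ℝ] ℝ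
  smooth : ∀ X Y Z : VField E M,
    ContMDiff 𝓘(ℝ, E) 𝓘(ℝ, ℝ) ∞ fun x => toFun x ![X x, Y x, Z x]

namespace ThreeForm

variable (η : ThreeForm E M)

/-- The smooth function `η(X, Y, Z)`. -/
def ev (X Y Z : VField E M) : C^∞⟮𝓘(ℝ, E), M; ℝ⟯ :=
  ⟨fun x => η.toFun x ![X x, Y x, Z x], η.smooth X Y Z⟩

/-- The exterior derivative of a 3-form, evaluated on vector fields. -/
def extDeriv (X Y Z W : VField E M) : C^∞⟮𝓘(ℝ, E), M; ℝ⟯ :=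
  X.deriv (η.ev Y Z W) - Y.deriv (η.ev X Z W) + Z.deriv (η.ev X Y W) - W.deriv (η.ev X Y Z)
    - η.ev (X.lie Y) Z W + η.ev (X.lie Z) Y W - η.ev (X.lie W) Y Z
    - η.ev (Y.lie Z) X W + η.ev (Y.lie W) X Z - η.ev (Z.lie W) X Y

/-- A 3-form is 2-plectic if it is closed and nondegenerate. -/
structure IsTwoPlectic : Prop where
  closed : ∀ X Y Z W, η.extDeriv X Y Z W = 0
  nondegenerate : ∀ (x : M) (v : TangentSpace 𝓘(ℝ, E) x),
    (∀ u w, η.toFun x ![v, u, w] = 0) → v = 0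

/-- `v` is a Hamiltonian vector field of the 1-form `α`: `dα = -ι_v η`. -/
def IsHamVField (α : OneForm E M) (v : VField E M) : Prop :=
  ∀ X Y, OneForm.extDeriv α X Y = -η.ev v X Y

section
variable {η} {x : M} (u v w a : TangentSpace 𝓘(ℝ, E) x)

lemma add₁ : η.toFun x ![u + a, v, w] = η.toFun x ![u, v, w] + η.toFun x ![a, v, w] := by
  have := (η.toFun x).map_update_add ![u, v, w] 0 u a
  have e : ∀ b, Function.update ![u, v, w] 0 b = ![b, v, w] := fun b => by
    ext i; fin_cases i <;> rfl
  rwa [e, e, e] at this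

lemma smul₁ (c : ℝ) : η.toFun x ![c • u, v, w] = c * η.toFun x ![u, v, w] := by
  have := (η.toFun x).map_update_smul ![u, v, w] 0 c u
  have e : ∀ b, Function.update ![u, v, w] 0 b = ![b, v, w] := fun b => by
    ext i; fin_cases i <;> rfl
  rwa [e, e] at this

lemma swap₁₂ : η.toFun x ![v, u, w] = -η.toFun x ![u, v, w] := by
  have := (η.toFun x).map_swap ![u, v, w] (i := 0) (j := 1) (by decide)
  rw [← this]
  congr 1
  ext i; fin_cases i <;> simp [Equiv.swap_apply_of_ne_of_ne]

lemma swap₂₃ : η.toFun x ![u, w, v] = -η.toFun x ![u, v, w] := by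
  have := (η.toFun x).map_swap ![u, v, w] (i := 1) (j := 2) (by decide)
  rw [← this]
  congr 1
  ext i; fin_cases i <;> simp [Equiv.swap_apply_of_ne_of_ne]

lemma add₂ : η.toFun x ![u, v + a, w] = η.toFun x ![u, v, w] + η.toFun x ![u, a, w] := by
  rw [swap₁₂, add₁, swap₁₂, swap₁₂ u a]; ring

lemma smul₂ (c : ℝ) : η.toFun x ![u, c • v, w] = c * η.toFun x ![u, v, w] := by
  rw [swap₁₂, smul₁, swap₁₂]; ring

lemma add₃ : η.toFun x ![u, v, w + a] = η.toFun x ![u, v, w] + η.toFun x ![u, v, a] := by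
  rw [swap₂₃, add₂, swap₂₃, swap₂₃ u v a]; ring

lemma smul₃ (c : ℝ) : η.toFun x ![u, v, c • w] = c * η.toFun x ![u, v, w] := by
  rw [swap₂₃, smul₂, swap₂₃]; ring

variable (X Y Z W : VField E M)

lemma ev_swap₁₂ : η.ev Y X Z = -η.ev X Y Z := by ext x; exact swap₁₂ ..
lemma ev_swap₂₃ : η.ev X Z Y = -η.ev X Y Z := by ext x; exact swap₂₃ ..
lemma ev_add₁ : η.ev (X + W) Y Z = η.ev X Y Z + η.ev W Y Z := by ext x; exact add₁ ..
lemma ev_smul₁ (c : ℝ) : η.ev (c • X) Y Z = c • η.ev X Y Z := by ext x; exact smul₁ ..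
lemma ev_add₂ : η.ev X (Y + W) Z = η.ev X Y Z + η.ev X W Z := by ext x; exact add₂ ..
lemma ev_smul₂ (c : ℝ) : η.ev X (c • Y) Z = c • η.ev X Y Z := by ext x; exact smul₂ ..
lemma ev_add₃ : η.ev X Y (Z + W) = η.ev X Y Z + η.ev X Y W := by ext x; exact add₃ ..
lemma ev_smul₃ (c : ℝ) : η.ev X Y (c • Z) = c • η.ev X Y Z := by ext x; exact smul₃ ..
lemma ev_neg₁ : η.ev (-X) Y Z = -η.ev X Y Z := by
  rw [← neg_one_smul ℝ X, ev_smul₁, neg_one_smul]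
lemma ev_neg₂ : η.ev X (-Y) Z = -η.ev X Y Z := by
  rw [← neg_one_smul ℝ Y, ev_smul₂, neg_one_smul]
lemma ev_neg₃ : η.ev X Y (-Z) = -η.ev X Y Z := by
  rw [← neg_one_smul ℝ Z, ev_smul₃, neg_one_smul]
lemma ev_zero₂ : η.ev X 0 Y = 0 := by
  rw [← zero_smul ℝ (0 : VField E M), ev_smul₂, zero_smul]
lemma ev_swap₁₃ : η.ev Z Y X = -η.ev X Y Z := by
  rw [ev_swap₁₂, ev_swap₂₃, ev_swap₁₂]; ring
lemma ev_cycle : η.ev Z X Y = η.ev X Y Z := by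
  rw [ev_swap₁₂, ev_swap₂₃, neg_neg]
lemma ev_fsmul₁ (f : C^∞⟮𝓘(ℝ, E), M; ℝ⟯) : η.ev (VField.fsmul f X) Y Z = f * η.ev X Y Z := by
  ext x; exact smul₁ ..
lemma ev_fsmul₂ (f : C^∞⟮𝓘(ℝ, E), M; ℝ⟯) : η.ev X (VField.fsmul f Y) Z = f * η.ev X Y Z := by
  ext x; exact smul₂ ..
end

section
variable (X Y Z W V : VField E M)

lemma extDeriv_swap₁₂ : η.extDeriv Y X Z W = -η.extDeriv X Y Z W := by
  simp only [extDeriv]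
  rw [VField.lie_swap Y X, ev_neg₁, ev_swap₁₂ X Y Z, ev_swap₁₂ X Y W, VField.deriv_neg,
    VField.deriv_neg, ev_swap₂₃ (Z.lie W) X Y]
  ring

lemma extDeriv_swap₂₃ : η.extDeriv X Z Y W = -η.extDeriv X Y Z W := by
  simp only [extDeriv]
  rw [VField.lie_swap Z Y, ev_neg₁, ev_swap₁₂ Y Z W, ev_swap₂₃ X Y Z, VField.deriv_neg,
    VField.deriv_neg, ev_swap₂₃ (X.lie W) Y Z]
  ring

lemma extDeriv_swap₃₄ : η.extDeriv X Y W Z = -η.extDeriv X Y Z W := by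
  simp only [extDeriv]
  rw [VField.lie_swap W Z, ev_neg₁, ev_swap₂₃ Y Z W, ev_swap₂₃ X Z W, VField.deriv_neg,
    VField.deriv_neg, ev_swap₂₃ (X.lie Y) Z W]
  ring

lemma extDeriv_add₁ : η.extDeriv (X + V) Y Z W = η.extDeriv X Y Z W + η.extDeriv V Y Z W := by
  simp only [extDeriv, VField.add_deriv, VField.add_lie, ev_add₁, ev_add₂, VField.deriv_add]
  ring

lemma extDeriv_fsmul₁ (f : C^∞⟮𝓘(ℝ, E), M; ℝ⟯) :
    η.extDeriv (VField.fsmul f X) Y Z W = f * η.extDeriv X Y Z W := by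
  simp only [extDeriv, VField.fsmul_deriv, VField.fsmul_lie, ev_add₁, ev_neg₁, ev_fsmul₁, ev_fsmul₂,
    VField.deriv_mul]
  ring

end

/-- `η` as a trilinear map on vector fields. -/
def tri : VField E M →ₗ[ℝ] VField E M →ₗ[ℝ] VField E M →ₗ[ℝ] C^∞⟮𝓘(ℝ, E), M; ℝ⟯ :=
  LinearMap.mk₂ ℝ (fun X Y =>
    { toFun := fun Z => η.ev X Y Z
      map_add' := fun _ _ => ev_add₃ ..
      map_smul' := fun _ _ => ev_smul₃ .. })
    (fun _ _ _ => by ext1 z; exact ev_add₁ ..) (fun _ _ _ => by ext1 z; exact ev_smul₁ ..)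
    (fun _ _ _ => by ext1 z; exact ev_add₂ ..) (fun _ _ _ => by ext1 z; exact ev_smul₂ ..)

@[simp] lemma tri_apply (X Y Z : VField E M) : η.tri X Y Z = η.ev X Y Z := rfl

/-- The contraction `ι_Y ι_X η = η(X, Y, ·)`. -/
def contract : VField E M →ₗ[ℝ] VField E M →ₗ[ℝ] OneForm E M :=
  LinearMap.mk₂ ℝ (fun X Y =>
      ⟨fun x =>
        { toFun := fun z => η.toFun x ![X x, Y x, z]
          map_add' := fun _ _ => add₃ ..
          map_smul' := fun _ _ => smul₃ .. }, η.smooth X Y⟩)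
    (fun _ _ _ => Subtype.ext <| funext fun _ => LinearMap.ext fun _ => add₁ ..)
    (fun _ _ _ => Subtype.ext <| funext fun _ => LinearMap.ext fun _ => smul₁ ..)
    (fun _ _ _ => Subtype.ext <| funext fun _ => LinearMap.ext fun _ => add₂ ..)
    (fun _ _ _ => Subtype.ext <| funext fun _ => LinearMap.ext fun _ => smul₂ ..)

@[simp] lemma contract_ev (X Y Z : VField E M) :
    OneForm.ev (η.contract X Y) Z = η.ev X Y Z := rfl

/-- The space of Hamiltonian 1-forms. -/
def Ham : Submodule ℝ (OneForm E M) where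
  carrier := {α | ∃ v, η.IsHamVField α v}
  add_mem' := by
    rintro α β ⟨v, hv⟩ ⟨w, hw⟩
    refine ⟨v + w, fun X Y => ?_⟩
    rw [OneForm.extDeriv_add, hv, hw, ev_add₁]; ring
  zero_mem' := ⟨0, fun X Y => by
    have := ev_smul₁ (η := η) 0 X Y 0
    rw [smul_zero, zero_smul] at this
    rw [this]
    simp [OneForm.extDeriv, VField.deriv_zero]⟩
  smul_mem' := by
    rintro c α ⟨v, hv⟩
    refine ⟨c • v, fun X Y => ?_⟩
    rw [OneForm.extDeriv_smul, hv, ev_smul₁, smul_neg]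

section TwoPlectic

variable {η} [T2Space M]

/-- `d d α = 0`. -/
lemma _root_.OneForm.extDeriv_extDeriv (α : OneForm E M) (X Y Z : VField E M) :
    X.deriv (OneForm.extDeriv α Y Z) - Y.deriv (OneForm.extDeriv α X Z)
      + Z.deriv (OneForm.extDeriv α X Y) - OneForm.extDeriv α (X.lie Y) Z
      + OneForm.extDeriv α (X.lie Z) Y - OneForm.extDeriv α (Y.lie Z) X = 0 := by
  have hj := congrArg (OneForm.ev α) (VField.jacobi X Y Z)
  rw [OneForm.ev_add, VField.lie_swap X (Y.lie Z), VField.lie_swap Y (X.lie Z), OneForm.ev_neg,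
    OneForm.ev_neg] at hj
  simp only [OneForm.extDeriv, VField.deriv_sub, VField.lie_deriv]
  linear_combination -hj

section Ham

variable {α β γ δ : OneForm E M} {a b c e : VField E M} (X Y Z : VField E M)

/-- If `v` is Hamiltonian then `d ι_v η = 0`. -/
lemma IsHamVField.closed (ha : η.IsHamVField α a) :
    X.deriv (η.ev a Y Z) - Y.deriv (η.ev a X Z) + Z.deriv (η.ev a X Y) - η.ev a (X.lie Y) Z
      + η.ev a (X.lie Z) Y - η.ev a (Y.lie Z) X = 0 := by
  have h := OneForm.extDeriv_extDeriv α X Y Z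
  simp only [ha _ _, VField.deriv_neg] at h
  linear_combination -h

/-- If `v` is Hamiltonian then `L_v η = 0`. -/
lemma IsHamVField.invariant (hη : η.IsTwoPlectic) (ha : η.IsHamVField α a) :
    a.deriv (η.ev X Y Z) = η.ev (a.lie X) Y Z + η.ev X (a.lie Y) Z + η.ev X Y (a.lie Z) := by
  have h1 := hη.closed a X Y Z
  have h2 := ha.closed X Y Z
  simp only [extDeriv] at h1
  linear_combination h1 + h2 - ev_swap₁₂ (η := η) (a.lie Y) X Z - ev_swap₂₃ (η := η) X Y (a.lie Z)
    + ev_swap₁₂ (η := η) X (a.lie Z) Y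
    + ev_swap₁₂ (η := η) (X.lie Y) a Z - ev_swap₁₂ (η := η) (X.lie Z) a Y
    + ev_swap₁₂ (η := η) (Y.lie Z) a X

/-- The bracket of Hamiltonian forms is Hamiltonian, with vector field `[v_α, v_β]`. -/
lemma IsHamVField.bracket (hη : η.IsTwoPlectic) (ha : η.IsHamVField α a) (hb : η.IsHamVField β b) :
    η.IsHamVField (η.contract a b) (a.lie b) := fun X Y => by
  have h1 := ha.invariant b X Y hη
  have h2 := hb.closed a X Y
  have h3 := congrArg X.deriv (ev_swap₁₂ (η := η) a b Y)
  have h4 := congrArg Y.deriv (ev_swap₁₂ (η := η) a b X)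
  rw [VField.deriv_neg] at h3 h4
  simp only [OneForm.extDeriv, contract_ev]
  linear_combination -h1 + h2 + h3 - h4 - ev_swap₁₂ (η := η) a b (X.lie Y)
    + ev_swap₂₃ (η := η) b (X.lie Y) a - ev_swap₂₃ (η := η) b X (a.lie Y)

lemma IsHamVField.jacobiator (hη : η.IsTwoPlectic) (ha : η.IsHamVField α a) (hb : η.IsHamVField β b)
    (hc : η.IsHamVField γ c) :
    X.deriv (η.ev c b a) = η.ev a (b.lie c) X - (η.ev (a.lie b) c X + η.ev b (a.lie c) X) := by
  have h0 := congrArg X.deriv (ev_swap₁₃ (η := η) a b c)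
  rw [VField.deriv_neg] at h0
  have h1 := ha.closed b c X
  have h2 := hb.invariant a c X hη
  have h3 := hc.invariant a b X hη
  rw [VField.lie_swap b a, ev_neg₁] at h2
  rw [VField.lie_swap c a, VField.lie_swap c b, ev_neg₁, ev_neg₂] at h3
  linear_combination h0 - h1 + h2 - h3 + ev_swap₂₃ (η := η) a (b.lie X) c
    - ev_swap₂₃ (η := η) a (c.lie X) b + ev_swap₁₂ (η := η) (a.lie c) b X

lemma IsHamVField.cocycle (hη : η.IsTwoPlectic) (ha : η.IsHamVField α a)
    (hb : η.IsHamVField β b) (hc : η.IsHamVField γ c) (he : η.IsHamVField δ e) :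
    η.ev a (b.lie c) e + η.ev a c (b.lie e) = η.ev a b (c.lie e) + η.ev (a.lie b) c e
      + η.ev b (a.lie c) e + η.ev b c (a.lie e) := by
  have h0 := hη.closed a b c e
  have h1 := ha.invariant b c e hη
  have h2 := hb.invariant a c e hη
  have h3 := hc.invariant a b e hη
  have h4 := he.invariant a b c hη
  simp only [extDeriv] at h0
  rw [VField.lie_swap b a, ev_neg₁] at h2
  rw [VField.lie_swap c a, VField.lie_swap c b, ev_neg₁, ev_neg₂] at h3
  rw [VField.lie_swap e a, VField.lie_swap e b, VField.lie_swap e c, ev_neg₁, ev_neg₂, ev_neg₃]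
    at h4
  rw [ev_swap₁₂ (η := η) b (a.lie c) e, ev_cycle (η := η) b c (a.lie e),
    ev_swap₁₂ (η := η) a (b.lie c) e, ev_cycle (η := η) a c (b.lie e),
    ev_cycle (η := η) a b (c.lie e)] at h0
  rw [ev_swap₁₂ (η := η) b (a.lie c) e] at h3
  rw [ev_cycle (η := η) b c (a.lie e), ev_swap₂₃ (η := η) a c (b.lie e)] at h4
  linear_combination -h0 + h1 - h2 + h3 - h4

end Ham

lemma IsTwoPlectic.ham_unique (hη : η.IsTwoPlectic) {α : OneForm E M} {v w : VField E M}
    (hv : η.IsHamVField α v) (hw : η.IsHamVField α w) : v = w := by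
  have h : ∀ X Y, η.ev (v + (-1 : ℝ) • w) X Y = 0 := fun X Y => by
    rw [ev_add₁, ev_smul₁, neg_one_smul]
    linear_combination (hv X Y).symm.trans (hw X Y) * (-1)
  have h0 : v + (-1 : ℝ) • w = 0 := by
    ext1 x
    refine hη.nondegenerate x _ fun u u' => ?_
    obtain ⟨X, rfl⟩ := VField.exists_extension x u
    obtain ⟨Y, rfl⟩ := VField.exists_extension x u'
    exact congrArg (fun f : C^∞⟮𝓘(ℝ, E), M; ℝ⟯ => f x) (h X Y)
  rw [neg_one_smul, ← sub_eq_add_neg, sub_eq_zero] at h0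
  exact h0

/-- Exact 1-forms are Hamiltonian, with Hamiltonian vector field `0`. -/
lemma isHamVField_diff (f : C^∞⟮𝓘(ℝ, E), M; ℝ⟯) : η.IsHamVField (diff f) 0 := fun X Y => by
  have := ev_smul₁ (η := η) 0 X Y 0
  rw [smul_zero, zero_smul] at this
  rw [this, OneForm.extDeriv, diff_ev, diff_ev, diff_ev, VField.lie_deriv]
  ring

variable (η) in
/-- The Hamiltonian vector field of a Hamiltonian 1-form. -/
def hamVField (hη : η.IsTwoPlectic) : η.Ham →ₗ[ℝ] VField E M where
  toFun α := α.2.choose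
  map_add' α β := hη.ham_unique (α + β).2.choose_spec fun X Y => by
    rw [Submodule.coe_add, OneForm.extDeriv_add, α.2.choose_spec, β.2.choose_spec, ev_add₁]; ring
  map_smul' c α := hη.ham_unique (c • α).2.choose_spec fun X Y => by
    rw [Submodule.coe_smul, OneForm.extDeriv_smul, α.2.choose_spec, RingHom.id_apply, ev_smul₁,
      smul_neg]

lemma isHamVField_hamVField (hη : η.IsTwoPlectic) (α : η.Ham) :
    η.IsHamVField α (η.hamVField hη α) := α.2.choose_spec

lemma hamVField_eq (hη : η.IsTwoPlectic) {α : η.Ham} {v : VField E M}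
    (hv : η.IsHamVField α v) : η.hamVField hη α = v :=
  hη.ham_unique (isHamVField_hamVField hη α) hv

variable (η) in
/-- The bracket `{α, β} = ι_{v_β} ι_{v_α} η` of Hamiltonian 1-forms. -/
def hamBracket (hη : η.IsTwoPlectic) : η.Ham →ₗ[ℝ] η.Ham →ₗ[ℝ] η.Ham :=
  LinearMap.mk₂ ℝ (fun α β => ⟨η.contract (η.hamVField hη α) (η.hamVField hη β), _,
      (isHamVField_hamVField hη α).bracket hη (isHamVField_hamVField hη β)⟩)
    (fun _ _ _ => Subtype.ext <| by simp) (fun _ _ _ => Subtype.ext <| by simp)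
    (fun _ _ _ => Subtype.ext <| by simp) (fun _ _ _ => Subtype.ext <| by simp)

lemma hamVField_hamBracket (hη : η.IsTwoPlectic) (α β : η.Ham) :
    η.hamVField hη (η.hamBracket hη α β) = (η.hamVField hη α).lie (η.hamVField hη β) :=
  hamVField_eq hη ((isHamVField_hamVField hη α).bracket hη (isHamVField_hamVField hη β))

lemma hamBracket_ev (hη : η.IsTwoPlectic) (α β : η.Ham) (X : VField E M) :
    OneForm.ev (η.hamBracket hη α β : OneForm E M) X
      = η.ev (η.hamVField hη α) (η.hamVField hη β) X := rfl

variable (η) in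
/-- The differential `C^∞(M) → Ω¹_Ham(M)`. -/
def hamDiff : C^∞⟮𝓘(ℝ, E), M; ℝ⟯ →ₗ[ℝ] η.Ham :=
  diff.codRestrict η.Ham fun f => ⟨0, isHamVField_diff f⟩

@[simp] lemma hamVField_hamDiff (hη : η.IsTwoPlectic) (f : C^∞⟮𝓘(ℝ, E), M; ℝ⟯) :
    η.hamVField hη (η.hamDiff f) = 0 := hamVField_eq hη (isHamVField_diff f)

variable (η) in
/-- The Jacobiator `J(α, β, γ) = ι_{v_α} ι_{v_β} ι_{v_γ} η = η(v_γ, v_β, v_α)`. -/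
def hamJacobiator (hη : η.IsTwoPlectic) :
    η.Ham →ₗ[ℝ] η.Ham →ₗ[ℝ] η.Ham →ₗ[ℝ] C^∞⟮𝓘(ℝ, E), M; ℝ⟯ :=
  LinearMap.mk₂ ℝ (fun α β =>
      (η.tri.flip (η.hamVField hη β)).flip (η.hamVField hη α) ∘ₗ η.hamVField hη)
    (fun _ _ _ => by ext1; simp) (fun _ _ _ => by ext1; simp)
    (fun _ _ _ => by ext1; simp) (fun _ _ _ => by ext1; simp)

lemma hamJacobiator_apply (hη : η.IsTwoPlectic) (α β γ : η.Ham) :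
    η.hamJacobiator hη α β γ
      = η.ev (η.hamVField hη γ) (η.hamVField hη β) (η.hamVField hη α) := rfl

lemma hamJacobiator_rev (hη : η.IsTwoPlectic) (α β γ : η.Ham) :
    η.hamJacobiator hη α β γ
      = -η.ev (η.hamVField hη α) (η.hamVField hη β) (η.hamVField hη γ) := by
  rw [hamJacobiator_apply, ev_swap₁₃]

variable (η) in
/-- The Lie 2-algebra of Hamiltonian 1-forms on the 2-plectic manifold `(M, η)`:
`L₀` is the space of Hamiltonian 1-forms, `L₁ = C^∞(M)`, `d` is the de Rham differential,
the bracket is `{α, β}` in degree 0 and zero otherwise. -/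
def hamLie2Algebra (hη : η.IsTwoPlectic) : Lie2Algebra.{max u v, v} where
  L0 := η.Ham
  L1 := C^∞⟮𝓘(ℝ, E), M; ℝ⟯
  d := η.hamDiff
  br := η.hamBracket hη
  act := 0
  br_skew α β := Subtype.ext <| OneForm.ext_ev fun X => ev_swap₁₂ ..
  d_act α f := by
    refine Subtype.ext <| OneForm.ext_ev fun X => ?_
    rw [hamBracket_ev, hamVField_hamDiff, ev_zero₂, LinearMap.zero_apply, LinearMap.zero_apply,
      map_zero]
    rfl
  act_d f g := by simp
  J := η.hamJacobiator hη
  J_skew₁₂ α β γ := ev_swap₂₃ ..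
  J_skew₂₃ α β γ := ev_swap₁₂ ..
  d_J α β γ := Subtype.ext <| OneForm.ext_ev fun X => by
    have := (isHamVField_hamVField hη α).jacobiator X hη (isHamVField_hamVField hη β)
      (isHamVField_hamVField hη γ)
    simp only [← hamVField_hamBracket] at this
    exact this
  J_d α β f := by simp [hamJacobiator]
  coherence α β γ δ := by
    have := (isHamVField_hamVField hη α).cocycle hη (isHamVField_hamVField hη β)
      (isHamVField_hamVField hη γ) (isHamVField_hamVField hη δ)
    simp only [← hamVField_hamBracket] at this
    simp only [LinearMap.zero_apply, zero_add, sub_zero, add_zero]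
    simp only [hamJacobiator_rev]
    linear_combination -this

end TwoPlectic
end ThreeForm
end Manifold

noncomputable section LieGroup

set_option linter.unusedSectionVars false

variable {E : Type u} [NormedAddCommGroup E] [NormedSpace ℝ E] [FiniteDimensional ℝ E]
  {G : Type v} [TopologicalSpace G] [ChartedSpace E G] [Group G] [LieGroup 𝓘(ℝ, E) ∞ G]

open Bundle

lemma mfderiv_mul_zero_left (p q : G) (v : TangentSpace 𝓘(ℝ, E) q) :
    mfderiv (𝓘(ℝ, E).prod 𝓘(ℝ, E)) 𝓘(ℝ, E) (fun r : G × G => r.1 * r.2) (p, q) ((0 : E), (v : E))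
      = mfderiv 𝓘(ℝ, E) 𝓘(ℝ, E) (fun h : G => p * h) q v := by
  refine (mfderiv_prod_eq_add_apply (p := (p, q))
    ((contMDiff_mul 𝓘(ℝ, E) ∞).mdifferentiableAt (by simp))).trans ?_
  let a : E := mfderiv 𝓘(ℝ, E) 𝓘(ℝ, E) (fun h : G => p * h) q v
  exact (congrArg (fun w : E => w + a)
    (map_zero (mfderiv 𝓘(ℝ, E) 𝓘(ℝ, E) (fun z : G => z * q) p))).trans (zero_add a)

/-- The left-invariant vector field with value `x` at the identity. -/
def leftInvariant (x : GroupLieAlgebra 𝓘(ℝ, E) G) : VField E G where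
  toFun := mulInvariantVectorField x
  contMDiff_toFun := by
    let fg : G → TangentBundle 𝓘(ℝ, E) G := fun g ↦ TotalSpace.mk' E g 0
    have sfg : CMDiff ∞ fg := contMDiff_zeroSection _ _
    let fv : G → TangentBundle 𝓘(ℝ, E) G := fun _ ↦ TotalSpace.mk' E 1 x
    have sfv : CMDiff ∞ fv := contMDiff_const
    let F₁ : G → (TangentBundle 𝓘(ℝ, E) G × TangentBundle 𝓘(ℝ, E) G) := fun g ↦ (fg g, fv g)
    have S₁ : CMDiff ∞ F₁ := sfg.prodMk sfv
    let F₂ : (TangentBundle 𝓘(ℝ, E) G × TangentBundle 𝓘(ℝ, E) G) →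
        TangentBundle (𝓘(ℝ, E).prod 𝓘(ℝ, E)) (G × G) :=
      (equivTangentBundleProd 𝓘(ℝ, E) G 𝓘(ℝ, E) G).symm
    have S₂ : CMDiff ∞ F₂ := contMDiff_equivTangentBundleProd_symm
    let F₃ : TangentBundle (𝓘(ℝ, E).prod 𝓘(ℝ, E)) (G × G) → TangentBundle 𝓘(ℝ, E) G :=
      tangentMap% (fun (p : G × G) ↦ p.1 * p.2)
    have S₃ : CMDiff ∞ F₃ :=
      ContMDiff.contMDiff_tangentMap (n := ∞) (m := ∞) (contMDiff_mul 𝓘(ℝ, E) ∞) (by simp)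
    let S := (S₃.comp S₂).comp S₁
    convert! S with g
    · simp [F₁, F₂, F₃, fg, fv]
    · exact (mfderiv_mul_zero_left g 1 x).symm

/-- The left-invariant Maurer-Cartan form `θ_L`, sending `v ∈ T_g G` to
`(L_{g⁻¹})_* v ∈ T_1 G`. -/
def maurerCartan (g : G) : TangentSpace 𝓘(ℝ, E) g →ₗ[ℝ] GroupLieAlgebra 𝓘(ℝ, E) G where
  toFun v := mfderiv 𝓘(ℝ, E) 𝓘(ℝ, E) (fun h : G => g⁻¹ * h) g v
  map_add' v w := map_add (mfderiv 𝓘(ℝ, E) 𝓘(ℝ, E) (fun h : G => g⁻¹ * h) g) v w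
  map_smul' c v := map_smul (mfderiv 𝓘(ℝ, E) 𝓘(ℝ, E) (fun h : G => g⁻¹ * h) g) c v

lemma tangentBundle_mk_eq {p q : G} (h : p = q) (v : E) :
    (TotalSpace.mk p v : TangentBundle 𝓘(ℝ, E) G) = TotalSpace.mk q v := by
  subst h; rfl

lemma contMDiff_maurerCartan (X : VField E G) :
    ContMDiff (M' := E) 𝓘(ℝ, E) 𝓘(ℝ, E) ∞ fun g => maurerCartan g (X g) := by
  let fg : G → TangentBundle 𝓘(ℝ, E) G := fun g ↦ TotalSpace.mk' E g⁻¹ 0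
  have sfg : CMDiff ∞ fg := (contMDiff_zeroSection _ _).comp (contMDiff_inv 𝓘(ℝ, E) ∞)
  let F₁ : G → (TangentBundle 𝓘(ℝ, E) G × TangentBundle 𝓘(ℝ, E) G) :=
    fun g ↦ (fg g, TotalSpace.mk' E g (X g))
  have S₁ : CMDiff ∞ F₁ := sfg.prodMk X.contMDiff
  let F₂ : (TangentBundle 𝓘(ℝ, E) G × TangentBundle 𝓘(ℝ, E) G) →
      TangentBundle (𝓘(ℝ, E).prod 𝓘(ℝ, E)) (G × G) :=
    (equivTangentBundleProd 𝓘(ℝ, E) G 𝓘(ℝ, E) G).symm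
  have S₂ : CMDiff ∞ F₂ := contMDiff_equivTangentBundleProd_symm
  let F₃ : TangentBundle (𝓘(ℝ, E).prod 𝓘(ℝ, E)) (G × G) → TangentBundle 𝓘(ℝ, E) G :=
    tangentMap% (fun (p : G × G) ↦ p.1 * p.2)
  have S₃ : CMDiff ∞ F₃ :=
    ContMDiff.contMDiff_tangentMap (n := ∞) (m := ∞) (contMDiff_mul 𝓘(ℝ, E) ∞) (by simp)
  have S := (S₃.comp S₂).comp S₁
  have hS : (F₃ ∘ F₂) ∘ F₁ = fun g =>
      (TotalSpace.mk (1 : G) (maurerCartan g (X g)) : TangentBundle 𝓘(ℝ, E) G) := by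
    ext1 g
    refine Eq.trans ?_ (tangentBundle_mk_eq (E := E) (inv_mul_cancel g) (maurerCartan g (X g) : E))
    exact congrArg (fun w : E => (TotalSpace.mk (g⁻¹ * g) w : TangentBundle 𝓘(ℝ, E) G))
      (mfderiv_mul_zero_left g⁻¹ g (X g))
  rw [hS] at S
  intro g
  have := (Bundle.contMDiffAt_totalSpace.1 (S g)).2
  refine this.congr_of_eventuallyEq (Filter.Eventually.of_forall fun h => ?_)
  exact ((tangentBundleCore 𝓘(ℝ, E) G).coordChange_self (achart E (1 : G)) 1
    (mem_chart_source E (1 : G)) (maurerCartan h (X h))).symm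

lemma maurerCartan_leftInvariant (x : GroupLieAlgebra 𝓘(ℝ, E) G) (g : G) :
    maurerCartan g (leftInvariant x g) = x := by
  have h := mfderiv_comp_apply (I := 𝓘(ℝ, E)) (I' := 𝓘(ℝ, E)) (I'' := 𝓘(ℝ, E)) (1 : G)
    (g := fun h : G => g⁻¹ * h) (f := fun h : G => g * h)
    ((contMDiff_mul_left (n := ∞)).mdifferentiableAt (by simp))
    ((contMDiff_mul_left (n := ∞)).mdifferentiableAt (by simp)) x
  have e : (fun h : G => g⁻¹ * h) ∘ (fun h : G => g * h) = id := by ext; simp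
  rw [e, mfderiv_id] at h
  have e2 : ∀ p : G, p = g → mfderiv 𝓘(ℝ, E) 𝓘(ℝ, E) (fun h : G => g⁻¹ * h) p
    (mfderiv 𝓘(ℝ, E) 𝓘(ℝ, E) (fun h : G => g * h) 1 x : E)
    = (mfderiv 𝓘(ℝ, E) 𝓘(ℝ, E) (fun h : G => g⁻¹ * h) g (leftInvariant x g) : E) := by
    rintro p rfl; rfl
  exact (e2 _ (mul_one g)).symm.trans h.symm

lemma leftInvariant_maurerCartan (g : G) (v : TangentSpace 𝓘(ℝ, E) g) :
    leftInvariant (maurerCartan g v) g = v := by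
  have h := mfderiv_comp_apply (I := 𝓘(ℝ, E)) (I' := 𝓘(ℝ, E)) (I'' := 𝓘(ℝ, E)) g
    (g := fun h : G => g * h) (f := fun h : G => g⁻¹ * h)
    ((contMDiff_mul_left (n := ∞)).mdifferentiableAt (by simp))
    ((contMDiff_mul_left (n := ∞)).mdifferentiableAt (by simp)) v
  have e : (fun h : G => g * h) ∘ (fun h : G => g⁻¹ * h) = id := by ext; simp
  rw [e, mfderiv_id] at h
  have e2 : ∀ p : G, p = 1 → mfderiv 𝓘(ℝ, E) 𝓘(ℝ, E) (fun h : G => g * h) p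
    (mfderiv 𝓘(ℝ, E) 𝓘(ℝ, E) (fun h : G => g⁻¹ * h) g v : E)
    = (mfderiv 𝓘(ℝ, E) 𝓘(ℝ, E) (fun h : G => g * h) 1 (maurerCartan g v) : E) := by
    rintro p rfl; rfl
  exact (e2 _ (inv_mul_cancel g)).symm.trans h.symm

lemma leftInvariant_lie (x y : GroupLieAlgebra 𝓘(ℝ, E) G) :
    (leftInvariant x).lie (leftInvariant y) = leftInvariant ⁅x, y⁆ := by
  ext1 g
  exact (congrFun (mulInvariantVector_mlieBracket x y) g).symm

namespace InvariantInnerProduct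

variable {𝔤 : Type u} [LieRing 𝔤] [LieAlgebra ℝ 𝔤] (B : InvariantInnerProduct 𝔤) (k : ℝ)

/-- The alternating form `(x, y, z) ↦ k ⟪x, [y, z]⟫`. -/
def alt : 𝔤 [⋀^Fin 3]→ₗ[ℝ] ℝ where
  toFun m := k * B.form (m 0) ⁅m 1, m 2⁆
  map_update_add' {inst} m i x y := by
    obtain rfl := Subsingleton.elim inst (instDecidableEqFin 3)
    fin_cases i <;> simp [Function.update] <;> ring
  map_update_smul' {inst} m i c x := by
    obtain rfl := Subsingleton.elim inst (instDecidableEqFin 3)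
    fin_cases i <;> simp [Function.update] <;> ring
  map_eq_zero_of_eq' m i j h hij := by
    have h1 := B.tri_skew₁₂ k (m 0) (m 1) (m 2)
    have h2 := B.tri_skew₂₃ k (m 0) (m 1) (m 2)
    have h3 := B.tri_skew₁₂ k (m 0) (m 2) (m 1)
    simp only [tri_apply] at h1 h2 h3
    fin_cases i <;> fin_cases j <;> simp at h hij <;> simp only [h] at h1 h2 h3 <;>
      simp only [h] <;> linarith

end InvariantInnerProduct

variable (B : InvariantInnerProduct (GroupLieAlgebra 𝓘(ℝ, E) G)) (k : ℝ)

/-- The 3-form `ν_k = k ⟪θ_L, [θ_L, θ_L]⟫`. -/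
def cartanForm : ThreeForm E G where
  toFun g := (B.alt k).compLinearMap (maurerCartan g)
  smooth X Y Z := by
    let b : Module.Basis _ ℝ (GroupLieAlgebra 𝓘(ℝ, E) G) := Module.finBasis ℝ E
    have hc : ∀ (X : VField E G) i,
        ContMDiff 𝓘(ℝ, E) 𝓘(ℝ, ℝ) ∞ fun g => b.repr (maurerCartan g (X g)) i := fun X i =>
      ContMDiff.comp (I' := 𝓘(ℝ, E)) (M' := E)
        (LinearMap.toContinuousLinearMap ((Module.finBasis ℝ E).coord i)).contMDiff
        (contMDiff_maurerCartan X)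
    have h : ∀ g, B.alt k (fun i => maurerCartan g (![X g, Y g, Z g] i)) =
        ∑ i, ∑ j, ∑ l, b.repr (maurerCartan g (X g)) i * (b.repr (maurerCartan g (Y g)) j
          * (b.repr (maurerCartan g (Z g)) l * B.tri k (b i) (b j) (b l))) := fun g => by
      change k * B.form (maurerCartan g (X g)) ⁅maurerCartan g (Y g), maurerCartan g (Z g)⁆ = _
      rw [← B.tri_apply]
      have e1 : ∀ x y z, B.tri k x y z = ∑ i, b.repr x i * B.tri k (b i) y z := fun x y z => by
        conv_lhs => rw [← b.sum_repr x]
        simp only [map_sum, map_smul, LinearMap.sum_apply, LinearMap.smul_apply, smul_eq_mul]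
      have e2 : ∀ x y z, B.tri k x y z = ∑ i, b.repr y i * B.tri k x (b i) z := fun x y z => by
        conv_lhs => rw [← b.sum_repr y]
        simp only [map_sum, map_smul, LinearMap.sum_apply, LinearMap.smul_apply, smul_eq_mul]
      have e3 : ∀ x y z, B.tri k x y z = ∑ i, b.repr z i * B.tri k x y (b i) := fun x y z => by
        conv_lhs => rw [← b.sum_repr z]
        simp only [map_sum, map_smul, smul_eq_mul]
      rw [e1]
      refine Finset.sum_congr rfl fun i _ => ?_
      rw [e2, Finset.mul_sum]
      refine Finset.sum_congr rfl fun j _ => ?_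
      rw [e3, Finset.mul_sum, Finset.mul_sum]
    change ContMDiff 𝓘(ℝ, E) 𝓘(ℝ, ℝ) ∞ fun g => B.alt k (fun i => maurerCartan g (![X g, Y g, Z g] i))
    simp only [h]
    refine ContMDiff.sum fun i _ => ContMDiff.sum fun j _ => ContMDiff.sum fun l _ => ?_
    exact (hc X i).mul ((hc Y j).mul ((hc Z l).mul contMDiff_const))

lemma cartanForm_apply (g : G) (u v w : TangentSpace 𝓘(ℝ, E) g) :
    (cartanForm B k).toFun g ![u, v, w]
      = B.tri k (maurerCartan g u) (maurerCartan g v) (maurerCartan g w) := by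
  rw [B.tri_apply]; rfl

lemma cartanForm_leftInvariant (x y z : GroupLieAlgebra 𝓘(ℝ, E) G) :
    (cartanForm B k).ev (leftInvariant x) (leftInvariant y) (leftInvariant z)
      = ContMDiffMap.const (B.tri k x y z) := by
  ext g
  refine (cartanForm_apply B k g _ _ _).trans ?_
  rw [maurerCartan_leftInvariant, maurerCartan_leftInvariant, maurerCartan_leftInvariant]; rfl

/-- Every vector field is a combination of left-invariant ones. -/
lemma exists_frame (X : VField E G) : ∃ f : Fin (Module.finrank ℝ E) → C^∞⟮𝓘(ℝ, E), G; ℝ⟯,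
    X = ∑ i, VField.fsmul (f i)
      (leftInvariant (Module.finBasis ℝ E i : GroupLieAlgebra 𝓘(ℝ, E) G)) := by
  let b : Module.Basis _ ℝ (GroupLieAlgebra 𝓘(ℝ, E) G) := Module.finBasis ℝ E
  refine ⟨fun i => ⟨fun g => b.repr (maurerCartan g (X g)) i, ContMDiff.comp (I' := 𝓘(ℝ, E)) (M' := E)
        (LinearMap.toContinuousLinearMap ((Module.finBasis ℝ E).coord i)).contMDiff
        (contMDiff_maurerCartan X)⟩, ?_⟩
  ext1 g
  have h : leftInvariant (∑ i, b.repr (maurerCartan g (X g)) i • b i) g = X g := by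
    rw [b.sum_repr, leftInvariant_maurerCartan]
  rw [← h]
  let L : GroupLieAlgebra 𝓘(ℝ, E) G →ₗ[ℝ] TangentSpace 𝓘(ℝ, E) g :=
    { toFun := fun v => leftInvariant v g
      map_add' := fun v w => map_add (mfderiv 𝓘(ℝ, E) 𝓘(ℝ, E) (fun h : G => g * h) 1) v w
      map_smul' := fun c v => map_smul (mfderiv 𝓘(ℝ, E) 𝓘(ℝ, E) (fun h : G => g * h) 1) c v }
  have h2 := map_sum L (fun i => b.repr (maurerCartan g (X g)) i • b i) Finset.univ
  refine h2.trans ?_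
  let ev : VField E G →+ TangentSpace 𝓘(ℝ, E) g := ⟨⟨fun Y => Y g, rfl⟩, fun _ _ => rfl⟩
  refine Eq.trans ?_ (map_sum ev _ Finset.univ).symm
  exact Finset.sum_congr rfl fun i _ => map_smul L _ _

lemma ThreeForm.extDeriv_eq_zero_of_left (η : ThreeForm E G) {Y Z W : VField E G}
    (h : ∀ x, η.extDeriv (leftInvariant x) Y Z W = 0) (X : VField E G) :
    η.extDeriv X Y Z W = 0 := by
  obtain ⟨f, rfl⟩ := exists_frame X
  let F : VField E G →+ C^∞⟮𝓘(ℝ, E), G; ℝ⟯ :=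
    AddMonoidHom.mk' (fun X => η.extDeriv X Y Z W) fun X V => η.extDeriv_add₁ X Y Z W V
  refine (map_sum F _ _).trans (Finset.sum_eq_zero fun i _ => ?_)
  exact (η.extDeriv_fsmul₁ _ Y Z W (f i)).trans ((congrArg _ (h _)).trans (mul_zero _))

lemma cartanForm_closed (X Y Z W : VField E G) : (cartanForm B k).extDeriv X Y Z W = 0 := by
  have h0 : ∀ x y z w, (cartanForm B k).extDeriv (leftInvariant x) (leftInvariant y)
      (leftInvariant z) (leftInvariant w) = 0 := fun x y z w => by
    simp only [ThreeForm.extDeriv, leftInvariant_lie, cartanForm_leftInvariant, VField.deriv_const]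
    have h1 := B.tri_cocycle k x y z w
    have h2 := B.tri_skew₁₂ k x ⁅y, z⁆ w
    have h3 := B.tri_skew₂₃ k x z ⁅y, w⁆
    have h4 := B.tri_skew₁₂ k x ⁅y, w⁆ z
    have h5 := B.tri_skew₂₃ k x y ⁅z, w⁆
    have h6 := B.tri_skew₁₂ k x ⁅z, w⁆ y
    have h7 := B.tri_skew₁₂ k y ⁅x, z⁆ w
    have h8 := B.tri_skew₂₃ k y z ⁅x, w⁆
    have h9 := B.tri_skew₁₂ k y ⁅x, w⁆ z
    ext g
    change (0 : ℝ) - 0 + 0 - 0 - B.tri k ⁅x, y⁆ z w + B.tri k ⁅x, z⁆ y w - B.tri k ⁅x, w⁆ y z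
      - B.tri k ⁅y, z⁆ x w + B.tri k ⁅y, w⁆ x z - B.tri k ⁅z, w⁆ x y = 0
    linarith
  have h1 : ∀ X y z w, (cartanForm B k).extDeriv X (leftInvariant y)
      (leftInvariant z) (leftInvariant w) = 0 := fun X y z w =>
    ThreeForm.extDeriv_eq_zero_of_left _ (fun x => h0 x y z w) X
  have h2 : ∀ X Y z w, (cartanForm B k).extDeriv X Y (leftInvariant z) (leftInvariant w) = 0 :=
    fun X Y z w => ThreeForm.extDeriv_eq_zero_of_left _ (fun x => by
      rw [ThreeForm.extDeriv_swap₁₂, h1, neg_zero]) X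
  have h3 : ∀ X Y Z w, (cartanForm B k).extDeriv X Y Z (leftInvariant w) = 0 :=
    fun X Y Z w => ThreeForm.extDeriv_eq_zero_of_left _ (fun x => by
      rw [ThreeForm.extDeriv_swap₁₂, ThreeForm.extDeriv_swap₂₃, h2, neg_zero, neg_zero]) X
  refine ThreeForm.extDeriv_eq_zero_of_left _ (fun x => ?_) X
  rw [ThreeForm.extDeriv_swap₁₂, ThreeForm.extDeriv_swap₂₃, ThreeForm.extDeriv_swap₃₄, h3]
  simp

lemma cartanForm_isTwoPlectic [LieAlgebra.IsSimple ℝ (GroupLieAlgebra 𝓘(ℝ, E) G)] {k : ℝ}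
    (hk : k ≠ 0) : (cartanForm B k).IsTwoPlectic where
  closed := cartanForm_closed B k
  nondegenerate g v h := by
    have h0 : maurerCartan g v ∈ LieAlgebra.center ℝ (GroupLieAlgebra 𝓘(ℝ, E) G) := by
      rw [LieModule.mem_maxTrivSubmodule]
      intro y
      by_contra hn
      have h1 := h (leftInvariant y g) (leftInvariant ⁅maurerCartan g v, y⁆ g)
      rw [cartanForm_apply, maurerCartan_leftInvariant, maurerCartan_leftInvariant, B.tri_apply,
        B.form_lie] at h1
      refine (B.pos ⁅maurerCartan g v, y⁆ ?_).ne' ((mul_eq_zero.1 h1).resolve_left hk)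
      rwa [← lie_skew, neg_ne_zero]
    rw [LieAlgebra.center_eq_bot] at h0
    rw [← leftInvariant_maurerCartan g v, (LieSubmodule.mem_bot _).1 h0]
    exact map_zero (mfderiv 𝓘(ℝ, E) 𝓘(ℝ, E) (fun h : G => g * h) 1)

end LieGroup

/-! A quasi-isomorphism in either direction induces a linear isomorphism on `H0`, so it suffices to
tell the two spaces `H0` apart by dimension. For the string Lie 2-algebra the differential is zero,
hence `H0` is the Lie algebra itself, of dimension n. For the Hamiltonian 1-forms, exact forms have
Hamiltonian vector field zero, so `α ↦ v_α` descends to `H0`. Its image contains every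
left-invariant and every right-invariant field, and these together span a space of dimension 2n. An
isomorphism would force 2n ≤ n, so n = 0, which a simple Lie algebra excludes.

Both families come from one formula. Let V♭ be the dual form ⟪θ_L(V), θ_L⟫. Invariance of the inner
product says that left-invariant fields preserve the metric, and this gives `extDeriv_flat`: dV♭(z,
w) = ⟪[z, V], w⟫ - ⟪[w, V], z⟫ + ⟪V, [z, w]⟫ for left-invariant z, w. The last term is ν_k(V, z,
w)/k. If V is right-invariant, the first two terms vanish because left and right translations
commute (`leftInvariant_lie_rightInvariant`), and -k V♭ is a potential. If V is left-invariant, each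
of the first two equals -⟪V, [z, w]⟫, and k V♭ is a potential.

The two families meet only in zero: a field in both commutes with all left-invariant fields, so its
value at the identity lies in the centre, which is trivial
(`coprod_leftInvariant_rightInvariant_injective`). -/

/-! ### Symmetry of mixed partial derivatives -/

open scoped Topology in
/-- Mixed partial derivatives of a `C²` function on a product commute. -/
lemma fderiv_fderiv_comm {E F : Type*} [NormedAddCommGroup E] [NormedSpace ℝ E]
    [NormedAddCommGroup F] [NormedSpace ℝ F] {ψ : E × F → ℝ} {a : E} {b : F}
    (h : ContDiffAt ℝ 2 ψ (a, b)) (y : E) (z : F) :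
    fderiv ℝ (fun q => fderiv ℝ (fun p => ψ (p, q)) a y) b z
      = fderiv ℝ (fun p => fderiv ℝ (fun q => ψ (p, q)) b z) a y := by
  -- The inner partial derivative gets differentiated again, so differentiability is needed at all
  -- points near `(a, b)`.
  have hd : ∀ᶠ r in 𝓝 (a, b), DifferentiableAt ℝ ψ r :=
    (h.eventually (by simp)).mono fun r hr => hr.differentiableAt (by simp)
  have h1 : (fun q => fderiv ℝ (fun p => ψ (p, q)) a y)
      =ᶠ[𝓝 b] fun q => fderiv ℝ ψ (a, q) (y, 0) := by
    have ht : Filter.Tendsto (fun q : F => (a, q)) (𝓝 b) (𝓝 (a, b)) :=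
      (Continuous.prodMk_right a).continuousAt
    filter_upwards [ht.eventually hd] with q hq
    have := HasFDerivAt.comp (f := fun p : E => (p, q)) a hq.hasFDerivAt (hasFDerivAt_prodMk_left a q)
    exact DFunLike.congr_fun this.fderiv y
  have h2 : (fun p => fderiv ℝ (fun q => ψ (p, q)) b z)
      =ᶠ[𝓝 a] fun p => fderiv ℝ ψ (p, b) (0, z) := by
    have ht : Filter.Tendsto (fun p : E => (p, b)) (𝓝 a) (𝓝 (a, b)) :=
      (Continuous.prodMk_left b).continuousAt
    filter_upwards [ht.eventually hd] with p hp
    have := HasFDerivAt.comp (f := fun q : F => (p, q)) b hp.hasFDerivAt (hasFDerivAt_prodMk_right p b)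
    exact DFunLike.congr_fun this.fderiv z
  have hs : DifferentiableAt ℝ (fderiv ℝ ψ) (a, b) :=
    (h.fderiv_right (m := 1) (by norm_num)).differentiableAt (by simp)
  have h3 := (HasFDerivAt.comp (f := fun q : F => (a, q)) b hs.hasFDerivAt
    (hasFDerivAt_prodMk_right a b)).clm_apply (hasFDerivAt_const ((y, 0) : E × F) b)
  have h4 := (HasFDerivAt.comp (f := fun p : E => (p, b)) a hs.hasFDerivAt
    (hasFDerivAt_prodMk_left a b)).clm_apply (hasFDerivAt_const ((0, z) : E × F) a)
  rw [h1.fderiv_eq, h2.fderiv_eq]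
  refine (DFunLike.congr_fun h3.fderiv z).trans (Eq.trans ?_ (DFunLike.congr_fun h4.fderiv y).symm)
  -- Both sides are now the second derivative of `ψ` on the vectors `(y, 0)` and `(0, z)`, in
  -- opposite orders.
  have hsymm := (h.isSymmSndFDerivAt (by simp)) (0, z) (y, 0)
  simpa using hsymm

/-! ### Vector fields as derivations -/

noncomputable section Manifold

set_option linter.unusedSectionVars false

variable {E : Type u} [NormedAddCommGroup E] [NormedSpace ℝ E] [FiniteDimensional ℝ E]
  {M : Type v} [TopologicalSpace M] [ChartedSpace E M] [IsManifold 𝓘(ℝ, E) ∞ M]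

lemma mfderiv_eq_fderiv_extChartAt_symm {f : M → ℝ} {x : M}
    (hf : MDifferentiableAt 𝓘(ℝ, E) 𝓘(ℝ, ℝ) f x) :
    (mfderiv 𝓘(ℝ, E) 𝓘(ℝ, ℝ) f x : E →L[ℝ] ℝ)
      = fderiv ℝ (fun a => f ((extChartAt 𝓘(ℝ, E) x).symm a)) (extChartAt 𝓘(ℝ, E) x x) := by
  have h : mfderiv 𝓘(ℝ, E) 𝓘(ℝ, ℝ) f x = fderivWithin ℝ
      (fun a => f ((extChartAt 𝓘(ℝ, E) x).symm a)) Set.univ (extChartAt 𝓘(ℝ, E) x x) :=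
    hf.mfderiv.trans (by rw [modelWithCornersSelf_coe, Set.range_id]; rfl)
  rw [fderivWithin_univ] at h
  exact h

namespace VField

/-- A nonzero tangent vector is detected by some linear functional in a chart, and a bump function
extends this local coordinate to a global smooth function. An identity between vector fields can
thus be checked on functions. -/
lemma eq_zero_of_deriv_eq_zero [T2Space M] {X : VField E M}
    (h : ∀ f : C^∞⟮𝓘(ℝ, E), M; ℝ⟯, X.deriv f = 0) : X = 0 := by
  ext1 x
  by_contra hx
  have hinv : (mfderiv 𝓘(ℝ, E) 𝓘(ℝ, E) (extChartAt 𝓘(ℝ, E) x) x).IsInvertible :=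
    isInvertible_mfderiv_extChartAt (mem_extChartAt_source x)
  let w : E := mfderiv 𝓘(ℝ, E) 𝓘(ℝ, E) (extChartAt 𝓘(ℝ, E) x) x (X x)
  have hw : w ≠ 0 := fun h0 => hx <| hinv.injective (h0.trans (map_zero _).symm)
  obtain ⟨ℓ, hℓ⟩ := Module.Projective.exists_dual_ne_zero ℝ hw
  let L : E →L[ℝ] ℝ := LinearMap.toContinuousLinearMap ℓ
  -- Any bump function centred at `x` will do; its support lies in the chart domain in any case.
  obtain ⟨χ, -, -⟩ := (SmoothBumpFunction.nhds_basis_tsupport (I := 𝓘(ℝ, E)) x).mem_iff.1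
    Filter.univ_mem
  have hL : ContMDiffOn 𝓘(ℝ, E) 𝓘(ℝ, ℝ) ∞ (fun p => L (extChartAt 𝓘(ℝ, E) x p))
      (chartAt E x).source := L.contMDiff.comp_contMDiffOn contMDiffOn_extChartAt
  let f : C^∞⟮𝓘(ℝ, E), M; ℝ⟯ := ⟨_, χ.contMDiff_smul hL⟩
  have hf : (f : M → ℝ) =ᶠ[nhds x] fun p => L (extChartAt 𝓘(ℝ, E) x p) := by
    filter_upwards [χ.eventuallyEq_one] with p hp
    change χ p • L _ = _
    rw [hp]; simp
  have h1 : mfderiv 𝓘(ℝ, E) 𝓘(ℝ, ℝ) f x (X x) = L w := by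
    rw [hf.mfderiv_eq]
    have h2 := mfderiv_comp_apply (I := 𝓘(ℝ, E)) (I' := 𝓘(ℝ, E)) (I'' := 𝓘(ℝ, ℝ)) x (g := L)
      (f := extChartAt 𝓘(ℝ, E) x) L.mdifferentiableAt
      (mdifferentiableAt_extChartAt (mem_chart_source E x)) (X x)
    refine h2.trans ?_
    rw [L.mfderiv_eq]
    rfl
  exact hℓ (h1.symm.trans (congrArg (fun f : C^∞⟮𝓘(ℝ, E), M; ℝ⟯ => f x) (h f)))

end VField

end Manifold

/-! ### Right-invariant fields and their commutation with left-invariant fields -/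

noncomputable section LieGroup

set_option linter.unusedSectionVars false

variable {E : Type u} [NormedAddCommGroup E] [NormedSpace ℝ E] [FiniteDimensional ℝ E]
  {G : Type v} [TopologicalSpace G] [ChartedSpace E G] [Group G] [LieGroup 𝓘(ℝ, E) ∞ G]

open Bundle

/-- The derivative of multiplication is the sum of its two partial derivatives, and the second is
applied to zero. This presents right-invariant fields through the tangent map of multiplication,
which makes them smooth. -/
lemma mfderiv_mul_zero_right (p q : G) (v : TangentSpace 𝓘(ℝ, E) p) :
    mfderiv (𝓘(ℝ, E).prod 𝓘(ℝ, E)) 𝓘(ℝ, E) (fun r : G × G => r.1 * r.2) (p, q) ((v : E), (0 : E))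
      = mfderiv 𝓘(ℝ, E) 𝓘(ℝ, E) (fun h : G => h * q) p v := by
  refine (mfderiv_prod_eq_add_apply (p := (p, q))
    ((contMDiff_mul 𝓘(ℝ, E) ∞).mdifferentiableAt (by simp))).trans ?_
  let a : E := mfderiv 𝓘(ℝ, E) 𝓘(ℝ, E) (fun h : G => h * q) p v
  exact (congrArg (fun w : E => a + w)
    (map_zero (mfderiv 𝓘(ℝ, E) 𝓘(ℝ, E) (fun z : G => p * z) q))).trans (add_zero a)

/-- The value at `g` of the right-invariant vector field with value `x` at the identity. -/
def rightInvariantAt (x : GroupLieAlgebra 𝓘(ℝ, E) G) (g : G) : TangentSpace 𝓘(ℝ, E) g :=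
  (mfderiv 𝓘(ℝ, E) 𝓘(ℝ, E) (fun h : G => h * g) 1 x : E)

/-- The right-invariant vector field with value `x` at the identity. -/
def rightInvariant (x : GroupLieAlgebra 𝓘(ℝ, E) G) : VField E G where
  toFun := rightInvariantAt x
  contMDiff_toFun := by
    -- The value at `g` is the tangent map of multiplication at `(1, g)` on the vector `(x, 0)`,
    -- hence a composite of smooth maps.
    let fg : G → TangentBundle 𝓘(ℝ, E) G := fun g ↦ TotalSpace.mk' E g 0
    have sfg : CMDiff ∞ fg := contMDiff_zeroSection _ _
    let fv : G → TangentBundle 𝓘(ℝ, E) G := fun _ ↦ TotalSpace.mk' E 1 x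
    have sfv : CMDiff ∞ fv := contMDiff_const
    let F₁ : G → (TangentBundle 𝓘(ℝ, E) G × TangentBundle 𝓘(ℝ, E) G) := fun g ↦ (fv g, fg g)
    have S₁ : CMDiff ∞ F₁ := sfv.prodMk sfg
    let F₂ : (TangentBundle 𝓘(ℝ, E) G × TangentBundle 𝓘(ℝ, E) G) →
        TangentBundle (𝓘(ℝ, E).prod 𝓘(ℝ, E)) (G × G) :=
      (equivTangentBundleProd 𝓘(ℝ, E) G 𝓘(ℝ, E) G).symm
    have S₂ : CMDiff ∞ F₂ := contMDiff_equivTangentBundleProd_symm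
    let F₃ : TangentBundle (𝓘(ℝ, E).prod 𝓘(ℝ, E)) (G × G) → TangentBundle 𝓘(ℝ, E) G :=
      tangentMap% (fun (p : G × G) ↦ p.1 * p.2)
    have S₃ : CMDiff ∞ F₃ :=
      ContMDiff.contMDiff_tangentMap (n := ∞) (m := ∞) (contMDiff_mul 𝓘(ℝ, E) ∞) (by simp)
    let S := (S₃.comp S₂).comp S₁
    convert! S with g
    · simp [F₁, F₂, F₃, fg, fv]
    · exact (mfderiv_mul_zero_right 1 g x).symm

/-- Chain rule for left translation by `g`. All derivatives are taken in the one chart at the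
identity, so that iterated derivatives become partial derivatives on a fixed vector space. -/
lemma leftInvariant_deriv_apply (x : GroupLieAlgebra 𝓘(ℝ, E) G) (f : C^∞⟮𝓘(ℝ, E), G; ℝ⟯) (g : G) :
    (leftInvariant x).deriv f g = fderiv ℝ (fun a => f (g * (extChartAt 𝓘(ℝ, E) (1 : G)).symm a))
      (extChartAt 𝓘(ℝ, E) (1 : G) 1) (x : E) := by
  have hm : ContMDiff 𝓘(ℝ, E) 𝓘(ℝ, E) ∞ fun h : G => g * h := contMDiff_mul_left
  have h1 := mfderiv_comp_apply (I := 𝓘(ℝ, E)) (I' := 𝓘(ℝ, E)) (I'' := 𝓘(ℝ, ℝ)) (1 : G) (g := f)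
    (f := fun h : G => g * h) (f.contMDiff.mdifferentiableAt (by simp))
    (hm.mdifferentiableAt (by simp)) x
  have h2 := mfderiv_eq_fderiv_extChartAt_symm (E := E) (x := (1 : G))
    ((f.contMDiff.comp hm).mdifferentiableAt (by simp))
  -- The chain rule differentiates `f` at `g * 1`, which is `g` only propositionally; a variable
  -- base point allows substitution.
  have e : ∀ p : G, p = g → (mfderiv 𝓘(ℝ, E) 𝓘(ℝ, ℝ) f p
    (mfderiv 𝓘(ℝ, E) 𝓘(ℝ, E) (fun h : G => g * h) 1 x : E) : ℝ)
    = mfderiv 𝓘(ℝ, E) 𝓘(ℝ, ℝ) f g (leftInvariant x g : E) := by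
    rintro p rfl; rfl
  exact (e _ (mul_one g)).symm.trans (h1.symm.trans (DFunLike.congr_fun h2 (x : E)))

lemma rightInvariant_deriv_apply (x : GroupLieAlgebra 𝓘(ℝ, E) G) (f : C^∞⟮𝓘(ℝ, E), G; ℝ⟯) (g : G) :
    (rightInvariant x).deriv f g = fderiv ℝ (fun a => f ((extChartAt 𝓘(ℝ, E) (1 : G)).symm a * g))
      (extChartAt 𝓘(ℝ, E) (1 : G) 1) (x : E) := by
  have hm : ContMDiff 𝓘(ℝ, E) 𝓘(ℝ, E) ∞ fun h : G => h * g := contMDiff_mul_right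
  have h1 := mfderiv_comp_apply (I := 𝓘(ℝ, E)) (I' := 𝓘(ℝ, E)) (I'' := 𝓘(ℝ, ℝ)) (1 : G) (g := f)
    (f := fun h : G => h * g) (f.contMDiff.mdifferentiableAt (by simp))
    (hm.mdifferentiableAt (by simp)) x
  have h2 := mfderiv_eq_fderiv_extChartAt_symm (E := E) (x := (1 : G))
    ((f.contMDiff.comp hm).mdifferentiableAt (by simp))
  have e : ∀ p : G, p = g → (mfderiv 𝓘(ℝ, E) 𝓘(ℝ, ℝ) f p
    (mfderiv 𝓘(ℝ, E) 𝓘(ℝ, E) (fun h : G => h * g) 1 x : E) : ℝ)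
    = mfderiv 𝓘(ℝ, E) 𝓘(ℝ, ℝ) f g (rightInvariant x g : E) := by
    rintro p rfl; rfl
  exact (e _ (one_mul g)).symm.trans (h1.symm.trans (DFunLike.congr_fun h2 (x : E)))

/-- Left-invariant and right-invariant vector fields commute. -/
lemma leftInvariant_lie_rightInvariant [T2Space G] (x y : GroupLieAlgebra 𝓘(ℝ, E) G) :
    (leftInvariant x).lie (rightInvariant y) = 0 := by
  refine VField.eq_zero_of_deriv_eq_zero fun f => ?_
  rw [VField.lie_deriv, sub_eq_zero]
  ext g
  rw [leftInvariant_deriv_apply, rightInvariant_deriv_apply]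
  simp only [leftInvariant_deriv_apply, rightInvariant_deriv_apply]
  let φ := extChartAt 𝓘(ℝ, E) (1 : G)
  have hφ : ContMDiffAt 𝓘(ℝ, E) 𝓘(ℝ, E) ∞ φ.symm (φ 1) :=
    (contMDiffOn_extChartAt_symm (1 : G)).contMDiffAt (extChartAt_target_mem_nhds (1 : G))
  have h₁ : ContMDiffAt 𝓘(ℝ, E × E) 𝓘(ℝ, E) ∞ (fun p : E × E => φ.symm p.1) (φ 1, φ 1) :=
    ContMDiffAt.comp (g := φ.symm) (f := fun p : E × E => p.1) (φ 1, φ 1) hφ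
      contDiff_fst.contMDiff.contMDiffAt
  have h₂ : ContMDiffAt 𝓘(ℝ, E × E) 𝓘(ℝ, E) ∞ (fun p : E × E => φ.symm p.2) (φ 1, φ 1) :=
    ContMDiffAt.comp (g := φ.symm) (f := fun p : E × E => p.2) (φ 1, φ 1) hφ
      contDiff_snd.contMDiff.contMDiffAt
  -- The first variable multiplies `g` on the left and yields the right-invariant derivative, the
  -- second yields the left-invariant one. Commutation is therefore the equality of mixed partials
  -- of this function.
  have hψ : ContDiffAt ℝ ∞ (fun p : E × E => f (φ.symm p.1 * g * φ.symm p.2)) (φ 1, φ 1) :=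
    contMDiffAt_iff_contDiffAt.1 <|
      f.contMDiff.contMDiffAt.comp (φ 1, φ 1) ((h₁.mul contMDiffAt_const).mul h₂)
  have h := fderiv_fderiv_comm (hψ.of_le ENat.LEInfty.out) (y : E) (x : E)
  simp only [mul_assoc] at h ⊢
  exact h

/-! ### Dual 1-forms and their exterior derivatives -/

namespace OneForm

variable (B : InvariantInnerProduct (GroupLieAlgebra 𝓘(ℝ, E) G))

/-- The 1-form `⟪θ_L(V), θ_L⟫` dual to the vector field `V`. -/
def flat (V : VField E G) : OneForm E G :=
  ⟨fun g => B.form (maurerCartan g (V g)) ∘ₗ maurerCartan g, fun X => by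
    let b : Module.Basis _ ℝ (GroupLieAlgebra 𝓘(ℝ, E) G) := Module.finBasis ℝ E
    have hc : ∀ (X : VField E G) i,
        ContMDiff 𝓘(ℝ, E) 𝓘(ℝ, ℝ) ∞ fun g => b.repr (maurerCartan g (X g)) i := fun X i =>
      ContMDiff.comp (I' := 𝓘(ℝ, E)) (M' := E)
        (LinearMap.toContinuousLinearMap ((Module.finBasis ℝ E).coord i)).contMDiff
        (contMDiff_maurerCartan X)
    -- In a basis, the function is a polynomial with constant coefficients in the smooth components
    -- of `θ_L(V)` and `θ_L(X)`.
    have h : ∀ g, B.form (maurerCartan g (V g)) (maurerCartan g (X g)) =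
        ∑ i, ∑ j, b.repr (maurerCartan g (V g)) i *
          (b.repr (maurerCartan g (X g)) j * B.form (b i) (b j)) := fun g => by
      conv_lhs => rw [← b.sum_repr (maurerCartan g (V g)), ← b.sum_repr (maurerCartan g (X g))]
      simp only [map_sum, map_smul, LinearMap.sum_apply, LinearMap.smul_apply, smul_eq_mul,
        Finset.mul_sum]
      rw [Finset.sum_comm]
      refine Finset.sum_congr rfl fun i _ => Finset.sum_congr rfl fun j _ => by ring
    change ContMDiff 𝓘(ℝ, E) 𝓘(ℝ, ℝ) ∞ fun g => B.form (maurerCartan g (V g)) (maurerCartan g (X g))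
    simp only [h]
    refine ContMDiff.sum fun i _ => ContMDiff.sum fun j _ => ?_
    exact (hc V i).mul ((hc X j).mul contMDiff_const)⟩

variable (V W X Y : VField E G) (x y z w : GroupLieAlgebra 𝓘(ℝ, E) G) (f : C^∞⟮𝓘(ℝ, E), G; ℝ⟯)

lemma flat_ev_apply (g : G) :
    ev (flat B V) X g = B.form (maurerCartan g (V g)) (maurerCartan g (X g)) := rfl

lemma flat_add : flat B (V + W) = flat B V + flat B W :=
  Subtype.ext <| funext fun g => LinearMap.ext fun v => by
    change B.form (maurerCartan g (V g + W g)) (maurerCartan g v) = _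
    rw [map_add, map_add]; rfl

lemma flat_zero : flat B (0 : VField E G) = 0 := by
  have h := flat_add B (0 : VField E G) 0
  rwa [add_zero, left_eq_add] at h

lemma flat_fsmul_ev : ev (flat B (VField.fsmul f V)) X = f * ev (flat B V) X := by
  ext g
  rw [flat_ev_apply, VField.fsmul_apply, map_smul, map_smul]; rfl

lemma flat_leftInvariant_ev :
    ev (flat B (leftInvariant x)) (leftInvariant y) = ContMDiffMap.const (B.form x y) := by
  ext g
  rw [flat_ev_apply, maurerCartan_leftInvariant, maurerCartan_leftInvariant]; rfl

/-- Left-invariant vector fields annihilate the metric `⟪θ_L, θ_L⟫`. -/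
lemma leftInvariant_deriv_flat_ev :
    (leftInvariant z).deriv (ev (flat B V) (leftInvariant w))
      = ev (flat B ((leftInvariant z).lie V)) (leftInvariant w)
        + ev (flat B V) ((leftInvariant z).lie (leftInvariant w)) := by
  obtain ⟨f, rfl⟩ := exists_frame V
  -- The difference of the two sides is additive in `V`, so it is enough that it vanishes on
  -- multiples `f · x` of left-invariant fields. There the terms with the derivative of `f` cancel,
  -- and the rest is invariance of the inner product.
  let D : VField E G →+ C^∞⟮𝓘(ℝ, E), G; ℝ⟯ :=
    AddMonoidHom.mk' (fun V => (leftInvariant z).deriv (ev (flat B V) (leftInvariant w))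
      - (ev (flat B ((leftInvariant z).lie V)) (leftInvariant w)
        + ev (flat B V) ((leftInvariant z).lie (leftInvariant w)))) fun V W => by
      simp only [flat_add, VField.lie_add, add_ev, VField.deriv_add]
      ring
  have hD : ∀ x f, D (VField.fsmul f (leftInvariant x)) = 0 := fun x f => by
    change (leftInvariant z).deriv (ev (flat B _) _) - (ev (flat B _) _ + ev (flat B _) _) = 0
    simp only [VField.lie_fsmul, flat_add, add_ev, flat_fsmul_ev, leftInvariant_lie,
      flat_leftInvariant_ev, VField.deriv_mul, VField.deriv_const]
    ext g
    change f g * 0 + B.form x w * _ - (_ * B.form x w + f g * B.form ⁅z, x⁆ w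
      + f g * B.form x ⁅z, w⁆) = (0 : ℝ)
    rw [B.invariant z x w]
    ring
  rw [← sub_eq_zero]
  exact (map_sum D _ _).trans (Finset.sum_eq_zero fun i _ => hD _ _)

/-- Metric invariance rewrites the two derivative terms of `dα`; of the three resulting terms ⟪V,
[z, w]⟫, up to sign, one survives. -/
lemma extDeriv_flat :
    extDeriv (flat B V) (leftInvariant z) (leftInvariant w)
      = ev (flat B ((leftInvariant z).lie V)) (leftInvariant w)
        - ev (flat B ((leftInvariant w).lie V)) (leftInvariant z)
        + ev (flat B V) (leftInvariant ⁅z, w⁆) := by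
  rw [extDeriv, leftInvariant_deriv_flat_ev, leftInvariant_deriv_flat_ev,
    VField.lie_swap (leftInvariant w) (leftInvariant z), ev_neg, leftInvariant_lie]
  ring

variable (α : OneForm E G)

lemma extDeriv_swap : extDeriv α Y X = -extDeriv α X Y := by
  rw [extDeriv, extDeriv, VField.lie_swap Y X, ev_neg]; ring

lemma extDeriv_add_left : extDeriv α (X + V) Y = extDeriv α X Y + extDeriv α V Y := by
  simp only [extDeriv, VField.add_deriv, VField.add_lie, ev_add, VField.deriv_add]
  ring

lemma ev_fsmul : ev α (VField.fsmul f X) = f * ev α X := by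
  ext g
  exact map_smul (α.1 g) (f g) (X g)

/-- The term `(Y f) α(X)` arises once from the Leibniz rule and once from the bracket, with opposite
signs. This tensoriality reduces the Hamiltonian equation to a frame. -/
lemma extDeriv_fsmul_left : extDeriv α (VField.fsmul f X) Y = f * extDeriv α X Y := by
  simp only [extDeriv, VField.fsmul_deriv, VField.fsmul_lie, ev_add, ev_neg, ev_fsmul,
    VField.deriv_mul]
  ring

end OneForm

namespace ThreeForm

variable {η : ThreeForm E G} {α : OneForm E G} {V : VField E G}

/-- A Hamiltonian vector field is recognised on left-invariant vector fields. -/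
lemma isHamVField_of_leftInvariant
    (h : ∀ x y, OneForm.extDeriv α (leftInvariant x) (leftInvariant y)
      = -η.ev V (leftInvariant x) (leftInvariant y)) : η.IsHamVField α V := by
  have hleft : ∀ Y, (∀ x, OneForm.extDeriv α (leftInvariant x) Y = -η.ev V (leftInvariant x) Y) →
      ∀ X, OneForm.extDeriv α X Y = -η.ev V X Y := fun Y hY X => by
    obtain ⟨f, rfl⟩ := exists_frame X
    let D : VField E G →+ C^∞⟮𝓘(ℝ, E), G; ℝ⟯ :=
      AddMonoidHom.mk' (fun X => OneForm.extDeriv α X Y + η.ev V X Y) fun X W => by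
        simp only [OneForm.extDeriv_add_left, ev_add₂]
        ring
    have hD : ∀ x f, D (VField.fsmul f (leftInvariant x)) = 0 := fun x f => by
      change OneForm.extDeriv α (VField.fsmul _ _) Y + η.ev V (VField.fsmul _ _) Y = 0
      rw [OneForm.extDeriv_fsmul_left, ev_fsmul₂, hY]
      ring
    rw [eq_neg_iff_add_eq_zero]
    exact (map_sum D _ _).trans (Finset.sum_eq_zero fun i _ => hD _ _)
  -- Skew-symmetry carries the frame argument from the first slot to the second.
  refine fun X Y => hleft Y (fun x => ?_) X
  rw [OneForm.extDeriv_swap, ev_swap₂₃, hleft _ (fun y => h y x) Y]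

end ThreeForm

/-! ### Hamiltonian potentials of the invariant fields -/

section cartanForm

variable (B : InvariantInnerProduct (GroupLieAlgebra 𝓘(ℝ, E) G)) (k : ℝ)

lemma cartanForm_ev_leftInvariant (V : VField E G) (z w : GroupLieAlgebra 𝓘(ℝ, E) G) :
    (cartanForm B k).ev V (leftInvariant z) (leftInvariant w)
      = k • OneForm.ev (OneForm.flat B V) (leftInvariant ⁅z, w⁆) := by
  ext g
  refine (cartanForm_apply B k g _ _ _).trans ?_
  rw [B.tri_apply, maurerCartan_leftInvariant, maurerCartan_leftInvariant]
  change _ = k * B.form _ (maurerCartan g (leftInvariant ⁅z, w⁆ g))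
  rw [maurerCartan_leftInvariant]

/-- In `extDeriv_flat` the bracket terms contribute -2⟪x, [z, w]⟫ by invariance, against +⟪x, [z,
w]⟫ from the last term. -/
lemma isHamVField_leftInvariant (x : GroupLieAlgebra 𝓘(ℝ, E) G) :
    (cartanForm B k).IsHamVField (k • OneForm.flat B (leftInvariant x)) (leftInvariant x) := by
  refine ThreeForm.isHamVField_of_leftInvariant fun z w => ?_
  rw [OneForm.extDeriv_smul, OneForm.extDeriv_flat, cartanForm_ev_leftInvariant]
  simp only [leftInvariant_lie, OneForm.flat_leftInvariant_ev]
  have h1 := B.invariant z x w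
  have h2 := B.invariant w x z
  rw [← lie_skew w z, map_neg] at h2
  ext g
  change k * (B.form ⁅z, x⁆ w - B.form ⁅w, x⁆ z + B.form x ⁅z, w⁆) = -(k * B.form x ⁅z, w⁆)
  linear_combination k * h1 - k * h2

/-- The bracket terms in `extDeriv_flat` vanish by commutation and only the last remains, so the
sign of the potential is opposite to the left-invariant case. -/
lemma isHamVField_rightInvariant [T2Space G] (y : GroupLieAlgebra 𝓘(ℝ, E) G) :
    (cartanForm B k).IsHamVField ((-k) • OneForm.flat B (rightInvariant y)) (rightInvariant y) := by
  refine ThreeForm.isHamVField_of_leftInvariant fun z w => ?_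
  rw [OneForm.extDeriv_smul, OneForm.extDeriv_flat, cartanForm_ev_leftInvariant,
    leftInvariant_lie_rightInvariant, leftInvariant_lie_rightInvariant, OneForm.flat_zero]
  simp

end cartanForm

/-! ### Independence of the two families and the dimension count -/

/-- The left-invariant vector field as a linear function of its value at the identity. -/
def leftInvariantₗ : GroupLieAlgebra 𝓘(ℝ, E) G →ₗ[ℝ] VField E G where
  toFun := leftInvariant
  map_add' x y := by
    ext1 g
    exact map_add (mfderiv 𝓘(ℝ, E) 𝓘(ℝ, E) (fun h : G => g * h) 1) x y
  map_smul' c x := by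
    ext1 g
    exact map_smul (mfderiv 𝓘(ℝ, E) 𝓘(ℝ, E) (fun h : G => g * h) 1) c x

/-- The right-invariant vector field as a linear function of its value at the identity. -/
def rightInvariantₗ : GroupLieAlgebra 𝓘(ℝ, E) G →ₗ[ℝ] VField E G where
  toFun := rightInvariant
  map_add' x y := by
    ext1 g
    exact map_add (mfderiv 𝓘(ℝ, E) 𝓘(ℝ, E) (fun h : G => h * g) 1) x y
  map_smul' c x := by
    ext1 g
    exact map_smul (mfderiv 𝓘(ℝ, E) 𝓘(ℝ, E) (fun h : G => h * g) 1) c x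

lemma leftInvariant_injective :
    Function.Injective (leftInvariant : GroupLieAlgebra 𝓘(ℝ, E) G → VField E G) := fun x y h => by
  rw [← maurerCartan_leftInvariant x 1, h, maurerCartan_leftInvariant]

lemma rightInvariant_apply_one (x : GroupLieAlgebra 𝓘(ℝ, E) G) : rightInvariant x 1 = x := by
  have e : (fun h : G => h * 1) = id := by ext; simp
  change mfderiv 𝓘(ℝ, E) 𝓘(ℝ, E) (fun h : G => h * 1) 1 x = x
  rw [e, mfderiv_id]
  rfl

/-- Bracketing a relation `x^L + y^R = 0` with any left-invariant field kills the right-invariant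
part, so `x` is central and hence zero; evaluation at the identity then gives `y = 0`. -/
lemma coprod_leftInvariant_rightInvariant_injective [T2Space G]
    [LieAlgebra.IsSimple ℝ (GroupLieAlgebra 𝓘(ℝ, E) G)] :
    Function.Injective
      ((leftInvariantₗ (E := E) (G := G)).coprod (rightInvariantₗ (E := E) (G := G))) := by
  rw [← LinearMap.ker_eq_bot, LinearMap.ker_eq_bot']
  rintro ⟨x, y⟩ h
  replace h : leftInvariant x + rightInvariant y = 0 := h
  have hx : x ∈ LieAlgebra.center ℝ (GroupLieAlgebra 𝓘(ℝ, E) G) := by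
    rw [LieModule.mem_maxTrivSubmodule]
    intro z
    refine leftInvariant_injective (E := E) (G := G) ?_
    have h0 : (leftInvariant z).lie (0 : VField E G) = 0 := by
      have := (leftInvariant z).lie_add (0 : VField E G) 0
      rwa [add_zero, left_eq_add] at this
    have h1 := congrArg (leftInvariant z).lie h
    rw [VField.lie_add, leftInvariant_lie_rightInvariant, leftInvariant_lie, add_zero, h0] at h1
    exact h1.trans (map_zero leftInvariantₗ).symm
  rw [LieAlgebra.center_eq_bot] at hx
  obtain rfl : x = 0 := (LieSubmodule.mem_bot _).1 hx
  have h2 : rightInvariant y = 0 := by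
    rw [← h]
    exact (zero_add (rightInvariant y)).symm.trans
      (congrArg (· + rightInvariant y) (map_zero leftInvariantₗ).symm)
  have hy : y = 0 := by
    rw [← rightInvariant_apply_one y, h2]
    rfl
  rw [hy]
  rfl

namespace ThreeForm

variable [T2Space G] {η : ThreeForm E G} (hη : η.IsTwoPlectic)

/-- The Hamiltonian vector field of a class in `H₀`, the Hamiltonian 1-forms modulo exact ones. -/
def hamVFieldH0 : Lie2Algebra.H0 (η.hamLie2Algebra hη) →ₗ[ℝ] VField E G :=
  Submodule.liftQ _ (η.hamVField hη) <| by
    rintro _ ⟨f, rfl⟩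
    exact hamVField_hamDiff hη f

lemma IsHamVField.mem_range_hamVFieldH0 {α : OneForm E G} {V : VField E G}
    (h : η.IsHamVField α V) : V ∈ LinearMap.range (hamVFieldH0 hη) :=
  ⟨Submodule.Quotient.mk (⟨α, V, h⟩ : η.Ham), hamVField_eq hη (α := ⟨α, V, h⟩) h⟩

end ThreeForm

/-- `H₀` of the Lie 2-algebra of Hamiltonian 1-forms is too large to be isomorphic to `𝔤`. -/
lemma isEmpty_linearEquiv_H0_hamLie2Algebra [T2Space G]
    [LieAlgebra.IsSimple ℝ (GroupLieAlgebra 𝓘(ℝ, E) G)]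
    (B : InvariantInnerProduct (GroupLieAlgebra 𝓘(ℝ, E) G)) {k : ℝ} (hk : k ≠ 0) :
    IsEmpty (GroupLieAlgebra 𝓘(ℝ, E) G ≃ₗ[ℝ] Lie2Algebra.H0
      (ThreeForm.hamLie2Algebra (cartanForm B k) (cartanForm_isTwoPlectic B hk))) := by
  refine ⟨fun e => ?_⟩
  let 𝔤 := GroupLieAlgebra 𝓘(ℝ, E) G
  have : FiniteDimensional ℝ 𝔤 := inferInstanceAs (FiniteDimensional ℝ E)
  let T : 𝔤 →ₗ[ℝ] VField E G :=
    ThreeForm.hamVFieldH0 (cartanForm_isTwoPlectic B hk) ∘ₗ e.toLinearMap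
  let S : 𝔤 × 𝔤 →ₗ[ℝ] VField E G := leftInvariantₗ.coprod rightInvariantₗ
  have hS : Function.Injective S := coprod_leftInvariant_rightInvariant_injective
  have hle : LinearMap.range S ≤ LinearMap.range T := by
    -- As `e` is onto, `T` has the same image as `hamVFieldH0`, which contains both families of
    -- invariant fields.
    rw [LinearMap.range_comp_of_range_eq_top _ (LinearEquiv.range e), LinearMap.range_coprod]
    refine sup_le ?_ ?_
    · rintro _ ⟨x, rfl⟩
      exact (isHamVField_leftInvariant B k x).mem_range_hamVFieldH0 _
    · rintro _ ⟨y, rfl⟩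
      exact (isHamVField_rightInvariant B k y).mem_range_hamVFieldH0 _
  have h1 := Submodule.finrank_mono hle
  rw [LinearMap.finrank_range_of_inj hS, Module.finrank_prod] at h1
  have h2 := LinearMap.finrank_range_le T
  -- The image of `S` has dimension 2n and lies in the image of `T`, of dimension at most n.
  have h3 : Module.finrank ℝ 𝔤 = 0 := by omega
  have h4 : Subsingleton 𝔤 := Module.finrank_zero_iff.1 h3
  -- A zero Lie algebra is abelian, contrary to simplicity.
  refine LieAlgebra.IsSimple.non_abelian ℝ (L := 𝔤) ⟨fun x y => h4.elim _ _⟩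

end LieGroup

theorem mainTheorem12 {E : Type*} [NormedAddCommGroup E] [NormedSpace ℝ E] [FiniteDimensional ℝ E]
    {G : Type*} [TopologicalSpace G] [ChartedSpace E G] [Group G] [LieGroup 𝓘(ℝ, E) ∞ G]
    [CompactSpace G] [T2Space G] [LieAlgebra.IsSimple ℝ (GroupLieAlgebra 𝓘(ℝ, E) G)]
    (B : InvariantInnerProduct (GroupLieAlgebra 𝓘(ℝ, E) G)) (k : ℝ) (hk : k ≠ 0) :
    ¬ Lie2Algebra.QuasiIsomorphic
      (ThreeForm.hamLie2Algebra (cartanForm B k) (cartanForm_isTwoPlectic B hk))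
      (B.stringLie2Algebra k) := by
  let e : (Lie2Algebra.H0 (B.stringLie2Algebra k)) ≃ₗ[ℝ] GroupLieAlgebra 𝓘(ℝ, E) G :=
    Submodule.quotEquivOfEqBot _ LinearMap.range_zero
  rintro (⟨φ, hφ⟩ | ⟨φ, hφ⟩)
  · exact (isEmpty_linearEquiv_H0_hamLie2Algebra B hk).false
      ((LinearEquiv.ofBijective φ.mapH0 hφ.2).trans e).symm
  · exact (isEmpty_linearEquiv_H0_hamLie2Algebra B hk).false
      (e.symm.trans (LinearEquiv.ofBijective φ.mapH0 hφ.2))
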